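/- \textbf{Theorem (Sinkhorn Marginal Complexity).} Let $\mathcal X\subset\mathbb R^d$ be compact, let $\rho$ be a Borel probability measure on $\mathcal X$, and let $K_0,K_1:\mathcal X\times\mathcal X\to\mathbb R$ be continuous covariance functions, that is, continuous, symmetric and positive semidefinite kernels. Denote also by $K_i$ the covariance operator on $L^2(\mathcal X,\rho)$ given by $[K_i\phi](x)=\int_{\mathcal X}K_i(x,s)\phi(s)\,d\rho(s)$, and let $\kappa_i=\sup_{x,y\in\mathcal X}|K_i(x,y)|$. Let $\epsilon>0$. For positive self-adjoint trace-class operators $A,B$ on a real Hilbert space put $$M_\epsilon(A,B)=-I+\Bigl(I+\tfrac{16}{\epsilon^2}A^{1/2}BA^{1/2}\Bigr)^{1/2},$$ $$W_{2,\epsilon}^2(A,B)=\operatorname{Tr}[A]+\operatorname{Tr}[B]+\tfrac{\epsilon}{2}\log\det\Bigl(I+\tfrac12M_\epsilon(A,B)\Bigr)-\tfrac{\epsilon}{2}\operatorname{Tr}[M_\epsilon(A,B)],$$ $$S_{2,\epsilon}(A,B)=W_{2,\epsilon}^2(A,B)-\tfrac12\bigl(W_{2,\epsilon}^2(A,A)+W_{2,\epsilon}^2(B,B)\bigr),$$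 where $\det$ is the Fredholm determinant; $S_{2,\epsilon}(A,B)$ is the $2$-Sinkhorn divergence between $A$ and $B$. Let $n\ge 1$, let $x_1,\dots,x_n$ be i.i.d. random points of $\mathcal X$ with law $\rho$, and let $S_{2,\epsilon}(K_0,K_1,n)=S_{2,\epsilon}(\Sigma^{(n)}_{K_0},\Sigma^{(n)}_{K_1})$ be the plug-in estimator built from the $n\times n$ matrices $(\Sigma^{(n)}_{K_i})_{jk}=\frac1nK_i(x_j,x_k)$. Then the estimation error is integrable and $$\mathbb E\,\bigl|S_{2,\epsilon}(K_0,K_1)-S_{2,\epsilon}(K_0,K_1,n)\bigr|\;\le\;\frac{4(\kappa_0+\kappa_1)^2}{\epsilon\sqrt n}.$$ In particular the bound does not depend on the dimension $d$. -/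

import Mathlib

open MeasureTheory ProbabilityTheory
open scoped InnerProductSpace

noncomputable section

namespace GPSinkhorn

section Operators

variable {H : Type*} [NormedAddCommGroup H] [InnerProductSpace ℝ H] [CompleteSpace H]

open Classical in
/-- The positive square root `A^{1/2}` of a bounded positive operator `A` on a real Hilbert space:
the (unique) bounded positive operator `B` with `B ∘ B = A`. It is `0` if there is none. -/
def opSqrt (A : H →L[ℝ] H) : H →L[ℝ] H :=
  if h : ∃ B : H →L[ℝ] H, B.IsPositive ∧ B ∘L B = A then h.choose else 0

/-- The trace `∑ₖ ⟪A eₖ, eₖ⟫` of an operator, along an orthonormal (Hilbert) basis `(eₖ)` of `H`.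
For a trace-class operator the value does not depend on the basis. -/
def opTrace (A : H →L[ℝ] H) : ℝ :=
  ∑' e : (exists_hilbertBasis ℝ H).choose, ⟪A (e : H), (e : H)⟫_ℝ

/-- The (Fredholm) determinant `det (I + A) = ∏ₖ (1 + λₖ)` of a self-adjoint trace-class operator
`A`, where `(λₖ)` are the eigenvalues of `A` repeated according to their multiplicities. A real
number `l` that is not an eigenvalue, and `l = 0`, contribute the factor `1`. -/
def opDetOneAdd (A : H →L[ℝ] H) : ℝ :=
  ∏' l : ℝ, (1 + l) ^ Module.finrank ℝ (Module.End.eigenspace (A : H →ₗ[ℝ] H) l)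

/-- `M_ε(A, B) = -I + (I + (16 / ε²) A^{1/2} B A^{1/2})^{1/2}`. -/
def entM (ε : ℝ) (A B : H →L[ℝ] H) : H →L[ℝ] H :=
  -ContinuousLinearMap.id ℝ H +
    opSqrt (ContinuousLinearMap.id ℝ H + (16 / ε ^ 2) • (opSqrt A ∘L B ∘L opSqrt A))

/-- The squared entropy-regularized 2-Wasserstein distance between two covariance operators,
`Tr A + Tr B + (ε/2) log det (I + M_ε(A, B)/2) - (ε/2) Tr M_ε(A, B)`. -/
def entW2Sq (ε : ℝ) (A B : H →L[ℝ] H) : ℝ :=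
  opTrace A + opTrace B
    + ε / 2 * Real.log (opDetOneAdd ((1 / 2 : ℝ) • entM ε A B))
    - ε / 2 * opTrace (entM ε A B)

/-- The 2-Sinkhorn divergence between two covariance operators. -/
def sinkhorn2 (ε : ℝ) (A B : H →L[ℝ] H) : ℝ :=
  entW2Sq ε A B - 1 / 2 * (entW2Sq ε A A + entW2Sq ε B B)

end Operators

section Kernels

variable {α : Type*} [TopologicalSpace α]

/-- A continuous covariance function (kernel): symmetric, and
`∑ᵢⱼ cᵢ cⱼ K(xᵢ, xⱼ) ≥ 0` for all finite families of points and real weights. -/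
def IsCovarianceKernel (K : C(α × α, ℝ)) : Prop :=
  (Matrix.of fun x y : α => K (x, y)).PosSemidef

/-- `κ = sup_{x, y} |K(x, y)|`. -/
def kernelSup (K : C(α × α, ℝ)) : ℝ := ⨆ p : α × α, |K p|

/-- The matrix `Σ_K^{(n)}` with entries `K(xᵢ, xⱼ) / n`, for a sample `x` of `n` points. -/
def empMatrix {n : ℕ} (K : C(α × α, ℝ)) (x : Fin n → α) : Matrix (Fin n) (Fin n) ℝ :=
  Matrix.of fun i j => 1 / (n : ℝ) * K (x i, x j)

/-- The `n`-marginal estimator `S_{2,ε}(K₀, K₁, n)`: the 2-Sinkhorn divergence between the matrices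
`Σ_{K₀}^{(n)}` and `Σ_{K₁}^{(n)}`, seen as operators on the Euclidean space `ℝⁿ`. -/
def empSinkhorn2 {n : ℕ} (ε : ℝ) (K₀ K₁ : C(α × α, ℝ)) (x : Fin n → α) : ℝ :=
  sinkhorn2 ε (Matrix.toEuclideanCLM (𝕜 := ℝ) (empMatrix K₀ x))
    (Matrix.toEuclideanCLM (𝕜 := ℝ) (empMatrix K₁ x))

variable [CompactSpace α] [MeasurableSpace α] [BorelSpace α]

/-- The sections `x ↦ K(x, ·)` of a continuous kernel, as a continuous map into `L²(ρ)`. -/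
def kernelSection (ρ : Measure α) [IsFiniteMeasure ρ] (K : C(α × α, ℝ)) : C(α, Lp ℝ 2 ρ) :=
  ContinuousMap.comp ⟨ContinuousMap.toLp 2 ρ ℝ, ContinuousLinearMap.continuous _⟩ K.curry

theorem integral_kernel_mul (ρ : Measure α) [IsFiniteMeasure ρ] (K : C(α × α, ℝ))
    (φ : Lp ℝ 2 ρ) (x : α) :
    ∫ s, K (x, s) * φ s ∂ρ = ⟪kernelSection ρ K x, φ⟫_ℝ := by
  rw [L2.inner_def]
  refine integral_congr_ae ?_
  filter_upwards [ContinuousMap.coeFn_toLp (p := 2) (𝕜 := ℝ) ρ (K.curry x)] with s hs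
  have h : (kernelSection ρ K x : α → ℝ) s = K (x, s) := hs
  rw [h]
  simp [mul_comm]

/-- The function `[Kφ](x) = ∫ K(x, s) φ(s) dρ(s)`, for `φ ∈ L²(ρ)`; it is continuous. -/
def kernelIntegral (ρ : Measure α) [IsFiniteMeasure ρ] (K : C(α × α, ℝ)) (φ : Lp ℝ 2 ρ) :
    C(α, ℝ) where
  toFun x := ∫ s, K (x, s) * φ s ∂ρ
  continuous_toFun := by
    simp only [integral_kernel_mul]
    exact (kernelSection ρ K).continuous.inner continuous_const

/-- The covariance operator `φ ↦ ∫ K(·, s) φ(s) dρ(s)` on `L²(ρ)`. -/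
def covOperator (ρ : Measure α) [IsFiniteMeasure ρ] (K : C(α × α, ℝ)) :
    Lp ℝ 2 ρ →L[ℝ] Lp ℝ 2 ρ :=
  ContinuousMap.toLp 2 ρ ℝ ∘L
    LinearMap.mkContinuous
      { toFun := kernelIntegral ρ K
        map_add' := fun φ ψ => by
          ext x
          simp only [kernelIntegral, integral_kernel_mul, inner_add_right, ContinuousMap.coe_mk,
            ContinuousMap.add_apply]
        map_smul' := fun c φ => by
          ext x
          simp only [kernelIntegral, integral_kernel_mul, inner_smul_right, ContinuousMap.coe_mk,
            ContinuousMap.smul_apply, smul_eq_mul, RingHom.id_apply] }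
      ‖kernelSection ρ K‖
      (fun φ => by
        refine (ContinuousMap.norm_le _ (by positivity)).2 fun x => ?_
        simp only [kernelIntegral, LinearMap.coe_mk, AddHom.coe_mk, ContinuousMap.coe_mk,
          integral_kernel_mul]
        exact (norm_inner_le_norm _ _).trans
          (mul_le_mul_of_nonneg_right ((kernelSection ρ K).norm_coe_le_norm x) (norm_nonneg _)))

/-- The covariance operator is the integral operator with kernel `K`. -/
theorem covOperator_apply_ae (ρ : Measure α) [IsFiniteMeasure ρ] (K : C(α × α, ℝ))
    (φ : Lp ℝ 2 ρ) :
    ∀ᵐ x ∂ρ, covOperator ρ K φ x = ∫ s, K (x, s) * φ s ∂ρ :=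
  ContinuousMap.coeFn_toLp (p := 2) (𝕜 := ℝ) ρ (kernelIntegral ρ K φ)

end Kernels

end GPSinkhorn

end

/-! The traces of `A` and `B` cancel in the Sinkhorn divergence, so only three interaction terms
`entTerm` matter. Each equals `-Tr f(A^{1/2} B A^{1/2})` with `f = entFun`, which on `[0, ∞)` is
concave, vanishes at `0` and has slope at most `2/ε` (`entTerm_of_diagonal`, `entFun_le_tangent`).

Population and sample operators act on different spaces, `L²(ρ)` and `ℝⁿ`. Feature maps `Φ₀`, `Φ₁`
of the kernels factor them as `A = J₀ J₀*`, `B = J₁ J₁*`; the nonzero spectrum of `A^{1/2} B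
A^{1/2}` is that of `R* R` with `R = J₀* J₁` (`entTerm_of_factorization`). This `R` acts between the
fixed feature spaces and is represented by the vector `T = E[Φ₀ ⊗ Φ₁]`, the mean being over `ρ` or
over the sample.

Peierls' inequality (`tsum_entFun_le`), the slope bound and Cauchy-Schwarz give the dimension-free
stability `|Δ| ≤ (2/ε) ‖T - T'‖ ‖T + T'‖` (`abs_entTerm_sub_le`). What remains is the law of large
numbers in a Hilbert space: vectors of norm at most `s = √(κ₀ κ₁)` have an empirical mean within
`s/√n` of `T` in expectation. -/

noncomputable section

namespace GPSinkhorn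

universe u

/-! ### Hilbert bases, diagonal operators and the spectral theorem. -/

section HilbertBasis

variable {H : Type u} [NormedAddCommGroup H] [InnerProductSpace ℝ H]

theorem _root_.HilbertBasis.ext_clm {ι F : Type*} [NormedAddCommGroup F] [NormedSpace ℝ F]
    (b : HilbertBasis ι ℝ H) {S T : H →L[ℝ] F} (h : ∀ i, S (b i) = T (b i)) : S = T := by
  refine ContinuousLinearMap.ext_on (s := Set.range b) ?_ ?_
  · have := b.dense_span
    rw [Submodule.dense_iff_topologicalClosure_eq_top]
    exact this
  · rintro _ ⟨i, rfl⟩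
    exact h i

theorem _root_.HilbertBasis.hasSum_inner_sq {ι : Type*} (b : HilbertBasis ι ℝ H) (x : H) :
    HasSum (fun i => ⟪b i, x⟫_ℝ ^ 2) (‖x‖ ^ 2) := by
  have h := b.hasSum_inner_mul_inner x x
  rw [real_inner_self_eq_norm_sq] at h
  refine h.congr_fun ?_
  intro i
  rw [real_inner_comm x (b i), sq]

/-- The operator that multiplies the `i`-th vector of a Hilbert basis by `m i`. -/
theorem exists_diagonal {ι : Type*} (b : HilbertBasis ι ℝ H) {m : ι → ℝ} {K : ℝ}
    (h0 : ∀ i, 0 ≤ m i) (hK : ∀ i, m i ≤ K) (hK0 : 0 ≤ K) :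
    ∃ D : H →L[ℝ] H, D.IsPositive ∧ ∀ i, D (b i) = m i • b i := by
  classical
  have hn : ∀ (f : lp (fun _ : ι => ℝ) 2) (i : ι), ‖m i * f i‖ ≤ ‖(K • f) i‖ := fun f i => by
    rw [lp.coeFn_smul, Pi.smul_apply, smul_eq_mul, norm_mul, norm_mul, Real.norm_eq_abs (m i),
      Real.norm_eq_abs K, abs_of_nonneg (h0 i), abs_of_nonneg hK0]
    exact mul_le_mul_of_nonneg_right (hK i) (norm_nonneg _)
  let L : lp (fun _ : ι => ℝ) 2 →L[ℝ] lp (fun _ : ι => ℝ) 2 := LinearMap.mkContinuous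
    { toFun := fun f => ⟨fun i => m i * f i, (lp.memℓp (K • f)).mono' (hn f)⟩
      map_add' := fun f g => by
        ext i
        exact mul_add _ _ _
      map_smul' := fun c f => by
        ext i
        simp [mul_left_comm] } K (fun f => by
      calc _ ≤ ‖K • f‖ := lp.norm_mono (by norm_num) (hn f)
        _ ≤ _ := by rw [norm_smul, Real.norm_eq_abs, abs_of_nonneg hK0])
  let D : H →L[ℝ] H := (b.repr.symm.toContinuousLinearEquiv : lp (fun _ : ι => ℝ) 2 →L[ℝ] H) ∘L L ∘L
    (b.repr.toContinuousLinearEquiv : H →L[ℝ] lp (fun _ : ι => ℝ) 2)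
  have hD : ∀ x i, ⟪b i, D x⟫_ℝ = m i * ⟪b i, x⟫_ℝ := fun x i => by
    rw [← b.repr_apply_apply, ← b.repr_apply_apply]
    have : b.repr (D x) = L (b.repr x) := b.repr.apply_symm_apply _
    rw [this]
    rfl
  refine ⟨D, (ContinuousLinearMap.isPositive_iff _).2 ⟨fun x y => ?_, fun x => ?_⟩, fun i => ?_⟩
  · change ⟪D x, y⟫_ℝ = ⟪x, D y⟫_ℝ
    rw [← b.tsum_inner_mul_inner, ← b.tsum_inner_mul_inner]
    refine tsum_congr fun i => ?_
    rw [hD, real_inner_comm (b i) (D x), hD, real_inner_comm (b i) x]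
    ring
  · rw [← b.tsum_inner_mul_inner]
    refine tsum_nonneg fun i => ?_
    rw [real_inner_comm (b i) (D x), hD, mul_assoc]
    exact mul_nonneg (h0 i) (mul_self_nonneg _)
  · apply b.repr.injective
    ext j
    rw [b.repr_apply_apply, b.repr_apply_apply, hD, inner_smul_right]
    by_cases hij : j = i
    · rw [hij]
    · rw [b.orthonormal.2 hij]; simp

variable [CompleteSpace H]

/-- Spectral theorem: a compact symmetric operator has a Hilbert basis of eigenvectors. -/
theorem exists_hilbertBasis_eigenvectors {T : H →L[ℝ] H} (hT : IsCompactOperator T)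
    (hs : T.IsSymmetric) :
    ∃ (ι : Type u) (b : HilbertBasis ι ℝ H) (c : ι → ℝ), ∀ i, T (b i) = c i • b i := by
  classical
  let V : ℝ → Submodule ℝ H := fun μ => Module.End.eigenspace (T : H →ₗ[ℝ] H) μ
  have hcl : ∀ μ, IsClosed (V μ : Set H) := fun μ => T.isClosed_eigenspace μ
  have : ∀ μ, CompleteSpace (V μ) := fun μ => (hcl μ).completeSpace_coe
  choose w b _hb using fun μ => exists_hilbertBasis ℝ (V μ)
  have hon : Orthonormal ℝ fun a : Σ μ, w μ => ((b a.1 a.2 : V a.1) : H) :=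
    hs.orthogonalFamily_eigenspaces.orthonormal_sigma_orthonormal fun μ => (b μ).orthonormal
  -- A vector orthogonal to a basis of every eigenspace is orthogonal to all eigenspaces, and these
  -- span densely because `T` is compact and symmetric.
  have hbot : (Submodule.span ℝ (Set.range fun a : Σ μ, w μ => ((b a.1 a.2 : V a.1) : H)))ᗮ = ⊥ := by
    rw [eq_bot_iff, ← ContinuousLinearMap.orthogonalComplement_iSup_eigenspaces_eq_bot hT hs]
    intro x hx
    rw [Submodule.mem_orthogonal] at hx
    rw [← Submodule.iInf_orthogonal, Submodule.mem_iInf]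
    intro μ
    rw [Submodule.mem_orthogonal]
    intro y hy
    have h := ((b μ).hasSum_repr ⟨y, hy⟩).mapL ((innerSL ℝ x).comp (V μ).subtypeL)
    have h0 : (fun i => ((innerSL ℝ x).comp (V μ).subtypeL) ((b μ).repr ⟨y, hy⟩ i • b μ i))
        = fun _ => (0 : ℝ) := by
      funext i
      have := hx _ (Submodule.subset_span ⟨⟨μ, i⟩, rfl⟩)
      rw [real_inner_comm] at this
      simp [this]
    rw [h0] at h
    have := h.unique hasSum_zero
    rw [real_inner_comm]
    simpa using this
  refine ⟨Σ μ, w μ, HilbertBasis.mkOfOrthogonalEqBot hon hbot, fun a => a.1, fun a => ?_⟩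
  rw [HilbertBasis.coe_mkOfOrthogonalEqBot]
  exact Module.End.mem_eigenspace_iff.1 (b a.1 a.2).2

end HilbertBasis

/-! ### Square root, trace and determinant of operators diagonal in a Hilbert basis. -/

section Operators

variable {H : Type u} [NormedAddCommGroup H] [InnerProductSpace ℝ H]

theorem opSqrt_spec {A : H →L[ℝ] H} (h : ∃ B : H →L[ℝ] H, B.IsPositive ∧ B ∘L B = A) :
    (opSqrt A).IsPositive ∧ opSqrt A ∘L opSqrt A = A := by
  rw [opSqrt, dif_pos h]
  exact h.choose_spec

/-- For `l > 0`, `(B + √l)(B - √l) x = 0` and `B + √l` is injective since `B ≥ 0`; for `l = 0`, `‖B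
x‖² = ⟪x, A x⟫ = 0`. Hence the choice made in `opSqrt` does not matter on eigenvectors. -/
theorem apply_eq_sqrt_smul {A B : H →L[ℝ] H} (hB : B.IsPositive) (hBA : B ∘L B = A) {x : H} {l : ℝ}
    (hl : 0 ≤ l) (hx : A x = l • x) : B x = √l • x := by
  have hBB : ∀ y, B (B y) = A y := fun y => by rw [← hBA]; rfl
  rcases hl.eq_or_lt with rfl | hl
  · have : ⟪B x, B x⟫_ℝ = 0 := by
      rw [hB.inner_left_eq_inner_right, hBB, hx]; simp
    rw [inner_self_eq_zero.1 this]; simp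
  · have hs : 0 < √l := Real.sqrt_pos.2 hl
    set y := B x - √l • x with hy
    have h1 : B y + √l • y = 0 := by
      rw [hy, map_sub, map_smul, hBB, hx, smul_sub, smul_smul, Real.mul_self_sqrt hl.le]
      abel
    have h2 : ⟪B y, y⟫_ℝ + √l * ‖y‖ ^ 2 = 0 := by
      rw [← real_inner_self_eq_norm_sq, ← real_inner_smul_left, ← inner_add_left, h1,
        inner_zero_left]
    have h3 := hB.inner_nonneg_left y
    have h4 : ‖y‖ ^ 2 = 0 := by nlinarith [sq_nonneg ‖y‖]
    rw [← sub_eq_zero, ← hy]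
    simpa using h4

theorem hasSum_inner_apply_of_diagonal {ι : Type*} (b : HilbertBasis ι ℝ H) {A : H →L[ℝ] H}
    {c : ι → ℝ} (hA : ∀ i, A (b i) = c i • b i) (x : H) :
    HasSum (fun i => c i * ⟪b i, x⟫_ℝ ^ 2) ⟪x, A x⟫_ℝ := by
  have h := (b.hasSum_repr x).mapL ((innerSL ℝ x).comp A)
  refine h.congr_fun fun i => ?_
  simp only [ContinuousLinearMap.comp_apply, map_smul, hA, b.repr_apply_apply, innerSL_apply_apply,
    smul_eq_mul, real_inner_comm x]
  ring

/-- Weighted sums of squared coefficients between two Hilbert bases. -/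
theorem hasSum_tsum_mul_inner_sq {ι κ : Type*} (b : HilbertBasis ι ℝ H) (w : HilbertBasis κ ℝ H)
    {a : ι → ℝ} (ha : ∀ i, 0 ≤ a i) (hs : Summable a) :
    (∀ j, Summable fun i => a i * ⟪b i, w j⟫_ℝ ^ 2) ∧
      HasSum (fun j => ∑' i, a i * ⟪b i, w j⟫_ℝ ^ 2) (∑' i, a i) := by
  have h1 : ∀ i, HasSum (fun j => a i * ⟪b i, w j⟫_ℝ ^ 2) (a i) := fun i => by
    have := (w.hasSum_inner_sq (b i)).mul_left (a i)
    rw [b.orthonormal.1 i, one_pow, mul_one] at this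
    simpa only [real_inner_comm] using this
  -- All terms are nonnegative, so the double sum may be taken in either order.
  have hp : Summable fun p : ι × κ => a p.1 * ⟪b p.1, w p.2⟫_ℝ ^ 2 := by
    rw [summable_prod_of_nonneg (fun p => mul_nonneg (ha _) (sq_nonneg _))]
    refine ⟨fun i => (h1 i).summable, ?_⟩
    simpa only [(h1 _).tsum_eq] using hs
  have hq := hp.prod_symm
  refine ⟨fun j => hq.prod_factor j, ?_⟩
  have h2 := hq.prod.hasSum
  have h3 := hp.tsum_comm (f := fun i j => a i * ⟪b i, w j⟫_ℝ ^ 2)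
  simp only [(h1 _).tsum_eq] at h3
  rw [← h3]
  exact h2

/-- An eigenvector for `l` has no coordinate outside the fibre `c i = l`. Finiteness of the fibre
makes its expansion a finite sum, so the algebraic span suffices. -/
theorem finrank_eigenspace_of_diagonal {ι : Type*} (b : HilbertBasis ι ℝ H) {A : H →L[ℝ] H}
    {c : ι → ℝ} (hA : ∀ i, A (b i) = c i • b i) (l : ℝ) (hl : {i | c i = l}.Finite) :
    Module.finrank ℝ (Module.End.eigenspace (A : H →ₗ[ℝ] H) l) = Nat.card {i // c i = l} := by
  classical
  have : Fintype {i // c i = l} := hl.fintype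
  have hsp : Module.End.eigenspace (A : H →ₗ[ℝ] H) l
      = Submodule.span ℝ (Set.range fun i : {i // c i = l} => b i) := by
    apply le_antisymm
    · intro x hx
      have hx : A x = l • x := Module.End.mem_eigenspace_iff.1 hx
      have h1 : HasSum (fun i => b.repr x i • c i • b i) (A x) := by
        simpa only [map_smul, hA] using (b.hasSum_repr x).mapL A
      have h3 : ∀ j, c j ≠ l → b.repr x j = 0 := fun j hj => by
        have h4 := h1.mapL (innerSL ℝ (b j))
        have h5 : innerSL ℝ (b j) (A x) = b.repr x j * c j := by
          have h6 := hasSum_single (f := fun i => innerSL ℝ (b j) (b.repr x i • c i • b i)) j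
            fun i hij => by
              rw [innerSL_apply_apply, inner_smul_right, inner_smul_right, b.orthonormal.2 hij.symm,
                mul_zero, mul_zero]
          rw [h4.unique h6, innerSL_apply_apply, inner_smul_right, inner_smul_right,
            real_inner_self_eq_norm_sq, b.orthonormal.1 j, one_pow, mul_one]
        rw [innerSL_apply_apply, hx, inner_smul_right, ← b.repr_apply_apply] at h5
        have : b.repr x j * (c j - l) = 0 := by linarith
        exact (mul_eq_zero.1 this).resolve_right (sub_ne_zero.2 hj)
      have h6 := b.hasSum_repr x
      have h7 : HasSum (fun i => b.repr x i • b i) (∑ i ∈ hl.toFinset, b.repr x i • b i) :=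
        hasSum_sum_of_ne_finset_zero fun i hi => by
          rw [h3 i (by simpa using hi), zero_smul]
      rw [h6.unique h7]
      refine Submodule.sum_mem _ fun i hi => Submodule.smul_mem _ _ (Submodule.subset_span ?_)
      exact ⟨⟨i, by simpa using hi⟩, rfl⟩
    · rw [Submodule.span_le]
      rintro _ ⟨i, rfl⟩
      refine Module.End.mem_eigenspace_iff.2 ?_
      change A (b i) = _
      rw [hA, i.2]
  rw [hsp, finrank_span_eq_card, Nat.card_eq_fintype_card]
  exact b.orthonormal.linearIndependent.comp _ Subtype.val_injective

theorem exists_sq_eq_of_diagonal {ι : Type*} (b : HilbertBasis ι ℝ H) {A : H →L[ℝ] H} {c : ι → ℝ}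
    (hc : ∀ i, 0 ≤ c i) (hA : ∀ i, A (b i) = c i • b i) :
    ∃ B : H →L[ℝ] H, B.IsPositive ∧ B ∘L B = A := by
  have hK : ∀ i, c i ≤ ‖A‖ := fun i => by
    have := A.le_opNorm (b i)
    rwa [hA, norm_smul, b.orthonormal.1 i, mul_one, mul_one, Real.norm_eq_abs,
      abs_of_nonneg (hc i)] at this
  obtain ⟨D, hD, hDb⟩ := exists_diagonal b (m := fun i => √(c i)) (K := √‖A‖)
    (fun i => Real.sqrt_nonneg _) (fun i => Real.sqrt_le_sqrt (hK i)) (Real.sqrt_nonneg _)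
  refine ⟨D, hD, b.ext_clm fun i => ?_⟩
  rw [ContinuousLinearMap.comp_apply, hDb, map_smul, hDb, smul_smul, Real.mul_self_sqrt (hc i), hA]

theorem opSqrt_apply_of_diagonal {ι : Type*} (b : HilbertBasis ι ℝ H) {A : H →L[ℝ] H} {c : ι → ℝ}
    (hc : ∀ i, 0 ≤ c i) (hA : ∀ i, A (b i) = c i • b i) (i : ι) :
    opSqrt A (b i) = √(c i) • b i :=
  have h := opSqrt_spec (exists_sq_eq_of_diagonal b hc hA)
  apply_eq_sqrt_smul h.1 h.2 (hc i) (hA i)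

/-- The sum over indices is regrouped along the fibres of `c`. Summability makes the fibres over `l
≠ 0` finite; the fibre over `0` may be infinite, but each of its terms is `log 1 = 0`. -/
theorem log_opDetOneAdd_of_diagonal {ι : Type*} (b : HilbertBasis ι ℝ H) {A : H →L[ℝ] H}
    {c : ι → ℝ} (hc : ∀ i, 0 ≤ c i) (hs : Summable c) (hA : ∀ i, A (b i) = c i • b i) :
    Real.log (opDetOneAdd A) = ∑' i, Real.log (1 + c i) := by
  have hfin : ∀ l, l ≠ 0 → {i | c i = l}.Finite := fun l hl => by
    have h := hs.tendsto_cofinite_zero.eventually_ne hl.symm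
    rw [Filter.eventually_cofinite] at h
    simpa using h
  have hlog : Summable fun i => Real.log (1 + c i) := by
    refine Summable.of_nonneg_of_le (fun i => Real.log_nonneg (by linarith [hc i])) (fun i => ?_) hs
    have := Real.log_le_sub_one_of_pos (show 0 < 1 + c i by linarith [hc i])
    linarith
  have hfac : ∀ l, HasSum (fun i : {i // c i = l} => Real.log (1 + c i))
      (Real.log ((1 + l) ^ Module.finrank ℝ (Module.End.eigenspace (A : H →ₗ[ℝ] H) l))) := by
    intro l
    rcases eq_or_ne l 0 with rfl | hl
    · simp only [add_zero, one_pow, Real.log_one]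
      convert hasSum_zero using 2 with i
      simp [i.2]
    · have : Fintype {i // c i = l} := (hfin l hl).fintype
      rw [finrank_eigenspace_of_diagonal b hA l (hfin l hl), Real.log_pow,
        Nat.card_eq_fintype_card]
      convert hasSum_fintype (fun i : {i // c i = l} => Real.log (1 + c i)) using 1
      rw [Finset.sum_congr rfl fun i _ => by rw [i.2]]
      simp
  have hpos : ∀ l : ℝ, 0 < (1 + l) ^ Module.finrank ℝ (Module.End.eigenspace (A : H →ₗ[ℝ] H) l) := by
    intro l
    rcases le_or_gt 0 l with hl | hl
    · positivity
    · have he : IsEmpty {i // c i = l} := ⟨fun i => by linarith [hc i, i.2]⟩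
      rw [finrank_eigenspace_of_diagonal b hA l (hfin l hl.ne)]
      simp
  have hsum := ((Equiv.sigmaFiberEquiv c).hasSum_iff.2 hlog.hasSum).sigma hfac
  rw [opDetOneAdd, ← Real.rexp_tsum_eq_tprod hpos hsum.summable, Real.log_exp, hsum.tsum_eq]

variable [CompleteSpace H]

theorem opSqrt_spec_of_isCompactOperator {A : H →L[ℝ] H} (hA : A.IsPositive)
    (hc : IsCompactOperator A) :
    (opSqrt A).IsPositive ∧ opSqrt A ∘L opSqrt A = A := by
  obtain ⟨ι, b, c, hb⟩ := exists_hilbertBasis_eigenvectors hc hA.isSymmetric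
  refine opSqrt_spec (exists_sq_eq_of_diagonal b (fun i => ?_) hb)
  have := hA.inner_nonneg_right (b i)
  rwa [hb, inner_smul_right, real_inner_self_eq_norm_sq, b.orthonormal.1 i, one_pow,
    mul_one] at this

theorem opTrace_of_diagonal {ι : Type*} (b : HilbertBasis ι ℝ H) {A : H →L[ℝ] H} {c : ι → ℝ}
    (hc : ∀ i, 0 ≤ c i) (hs : Summable c) (hA : ∀ i, A (b i) = c i • b i) :
    opTrace A = ∑' i, c i := by
  obtain ⟨w, hw⟩ := (exists_hilbertBasis ℝ H).choose_spec
  have h2 := (hasSum_tsum_mul_inner_sq b w hc hs).2.tsum_eq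
  rw [← h2, opTrace]
  refine tsum_congr fun j => ?_
  rw [(hasSum_inner_apply_of_diagonal b hA _).tsum_eq, real_inner_comm, hw]

end Operators

/-! ### The concave scalar function behind the entropic term. -/

section ScalarFunction

/-- The scalar function `γ ↦ (1 + 16 γ / ε²)^{1/2} - 1` underlying `entM`. -/
def entShift (ε c : ℝ) : ℝ := √(1 + 16 / ε ^ 2 * c) - 1

/-- The scalar function whose trace is the entropic interaction term of `entW2Sq`. -/
def entFun (ε c : ℝ) : ℝ := ε / 2 * (entShift ε c - Real.log (1 + 1 / 2 * entShift ε c))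

/-- The derivative of `entFun`. -/
def entSlope (ε c : ℝ) : ℝ := 4 / (ε * (2 + entShift ε c))

variable {ε : ℝ} {a c : ℝ}

theorem entShift_zero : entShift ε 0 = 0 := by simp [entShift]

theorem entFun_zero : entFun ε 0 = 0 := by simp [entFun, entShift_zero]

theorem entShift_nonneg (hc : 0 ≤ c) : 0 ≤ entShift ε c := by
  have : 0 ≤ 16 / ε ^ 2 * c := by positivity
  rw [entShift, sub_nonneg, Real.one_le_sqrt]
  linarith

theorem entShift_sq (hc : 0 ≤ c) : (1 + entShift ε c) ^ 2 = 1 + 16 / ε ^ 2 * c := by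
  have : 0 ≤ 16 / ε ^ 2 * c := by positivity
  rw [entShift, add_sub_cancel, Real.sq_sqrt (by linarith)]

theorem entShift_le (hc : 0 ≤ c) : entShift ε c ≤ 8 / ε ^ 2 * c := by
  have h := entShift_sq (ε := ε) hc
  have : 16 / ε ^ 2 * c = 2 * (8 / ε ^ 2 * c) := by ring
  nlinarith [sq_nonneg (entShift ε c)]

theorem entFun_nonneg (hε : 0 < ε) (hc : 0 ≤ c) : 0 ≤ entFun ε c := by
  have h := entShift_nonneg (ε := ε) hc
  have := Real.log_le_sub_one_of_pos (show 0 < 1 + 1 / 2 * entShift ε c by linarith)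
  exact mul_nonneg (by linarith) (by linarith)

theorem entSlope_nonneg (hε : 0 < ε) (hc : 0 ≤ c) : 0 ≤ entSlope ε c := by
  have h := entShift_nonneg (ε := ε) hc
  unfold entSlope
  positivity

theorem entSlope_le (hε : 0 < ε) (hc : 0 ≤ c) : entSlope ε c ≤ 2 / ε := by
  have h := entShift_nonneg (ε := ε) hc
  unfold entSlope
  rw [div_le_div_iff₀ (by positivity) hε]
  nlinarith

/-- `entFun` is concave: its graph lies below its tangents. -/
theorem entFun_le_tangent (hε : 0 < ε) (ha : 0 ≤ a) (hc : 0 ≤ c) :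
    entFun ε c ≤ entFun ε a + entSlope ε a * (c - a) := by
  have hm := entShift_nonneg (ε := ε) hc
  have hp := entShift_nonneg (ε := ε) ha
  have hc' := entShift_sq (ε := ε) hc
  have ha' := entShift_sq (ε := ε) ha
  unfold entFun entSlope
  generalize entShift ε c = m at *
  generalize entShift ε a = p at *
  -- Solving for `c` and `a` in terms of the shifts `m` and `p` leaves an inequality that is
  -- rational apart from one logarithm, which is handled by `log u ≤ u - 1`.
  have hca : c - a = ε ^ 2 / 16 * ((1 + m) ^ 2 - (1 + p) ^ 2) := by
    rw [hc', ha']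
    field_simp
    ring
  have hlog : Real.log (1 + 1 / 2 * p) - Real.log (1 + 1 / 2 * m) ≤ (p - m) / (2 + m) := by
    rw [← Real.log_div (by positivity) (by positivity)]
    refine (Real.log_le_sub_one_of_pos (by positivity)).trans (le_of_eq ?_)
    field_simp
    ring
  have hsl : 4 / (ε * (2 + p)) * (c - a) = ε / 2 * ((m - p) * (m + p + 2) / (2 * (2 + p))) := by
    rw [hca]
    field_simp
    ring
  have hfin : (m - p) + (p - m) / (2 + m) ≤ (m - p) * (m + p + 2) / (2 * (2 + p)) := by
    have : (m - p) * (m + p + 2) / (2 * (2 + p)) - ((m - p) + (p - m) / (2 + m))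
        = (m - p) ^ 2 * m / (2 * (2 + p) * (2 + m)) := by
      field_simp
      ring
    have h2 : 0 ≤ (m - p) ^ 2 * m / (2 * (2 + p) * (2 + m)) := by positivity
    linarith
  rw [hsl, ← mul_add]
  refine mul_le_mul_of_nonneg_left ?_ (by positivity)
  linarith

theorem entFun_sub_le (hε : 0 < ε) (ha : 0 ≤ a) (hc : 0 ≤ c) :
    entFun ε c - entFun ε a ≤ 2 / ε * |c - a| := by
  have h1 := entFun_le_tangent hε ha hc
  have h2 : entSlope ε a * (c - a) ≤ entSlope ε a * |c - a| :=
    mul_le_mul_of_nonneg_left (le_abs_self _) (entSlope_nonneg hε ha)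
  have h3 := mul_le_mul_of_nonneg_right (entSlope_le hε ha) (abs_nonneg (c - a))
  linarith

theorem entFun_le (hε : 0 < ε) (hc : 0 ≤ c) : entFun ε c ≤ 2 / ε * c := by
  have := entFun_sub_le hε le_rfl hc
  rwa [entFun_zero, sub_zero, sub_zero, abs_of_nonneg hc] at this

theorem summable_entFun {ι : Type*} {c : ι → ℝ} (hε : 0 < ε) (hc : ∀ i, 0 ≤ c i)
    (hs : Summable c) : Summable fun i => entFun ε (c i) :=
  Summable.of_nonneg_of_le (fun i => entFun_nonneg hε (hc i)) (fun i => entFun_le hε (hc i))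
    (hs.mul_left _)

end ScalarFunction

/-! ### The interaction term as a spectral sum. -/

section EntropicTerm

variable {H : Type u} [NormedAddCommGroup H] [InnerProductSpace ℝ H]

theorem entM_apply_of_diagonal {ι : Type*} (b : HilbertBasis ι ℝ H) {A B : H →L[ℝ] H} {c : ι → ℝ}
    (hc : ∀ i, 0 ≤ c i) (hb : ∀ i, (opSqrt A ∘L B ∘L opSqrt A) (b i) = c i • b i) (ε : ℝ) (i : ι) :
    entM ε A B (b i) = entShift ε (c i) • b i := by
  have h := opSqrt_apply_of_diagonal b (c := fun i => 1 + 16 / ε ^ 2 * c i)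
    (A := ContinuousLinearMap.id ℝ H + (16 / ε ^ 2) • (opSqrt A ∘L B ∘L opSqrt A))
    (fun i => by have := hc i; positivity) (fun i => by
      rw [add_apply, smul_apply, hb,
        ContinuousLinearMap.id_apply, add_smul, one_smul, smul_smul]) i
  rw [entM, add_apply, h, neg_apply,
    ContinuousLinearMap.id_apply, entShift, sub_smul, one_smul]
  abel

variable [CompleteSpace H]

/-- The interaction part `entW2Sq ε A B - Tr A - Tr B`. -/
def entTerm (ε : ℝ) (A B : H →L[ℝ] H) : ℝ := entW2Sq ε A B - opTrace A - opTrace B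

theorem sinkhorn2_eq_entTerm (ε : ℝ) (A B : H →L[ℝ] H) :
    sinkhorn2 ε A B = entTerm ε A B - 1 / 2 * (entTerm ε A A + entTerm ε B B) := by
  unfold sinkhorn2 entTerm
  ring

theorem entTerm_of_diagonal {ι : Type*} (b : HilbertBasis ι ℝ H) {A B : H →L[ℝ] H} {c : ι → ℝ}
    (hc : ∀ i, 0 ≤ c i) (hs : Summable c)
    (hb : ∀ i, (opSqrt A ∘L B ∘L opSqrt A) (b i) = c i • b i) (ε : ℝ) :
    entTerm ε A B = -∑' i, entFun ε (c i) := by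
  have hM := entM_apply_of_diagonal b hc hb ε
  have hm : ∀ i, 0 ≤ entShift ε (c i) := fun i => entShift_nonneg (hc i)
  have hms : Summable fun i => entShift ε (c i) :=
    Summable.of_nonneg_of_le hm (fun i => entShift_le (hc i)) (hs.mul_left _)
  have htr := opTrace_of_diagonal b hm hms hM
  have hm2 : ∀ i, 0 ≤ 1 / 2 * entShift ε (c i) := fun i => by linarith [hm i]
  have hdet := log_opDetOneAdd_of_diagonal b (A := (1 / 2 : ℝ) • entM ε A B) hm2
    (hms.mul_left _) (fun i => by rw [smul_apply, hM, smul_smul])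
  have hlog : Summable fun i => Real.log (1 + 1 / 2 * entShift ε (c i)) :=
    Summable.of_nonneg_of_le (fun i => Real.log_nonneg (by linarith [hm2 i]))
      (fun i => by
        have := Real.log_le_sub_one_of_pos (show 0 < 1 + 1 / 2 * entShift ε (c i) by linarith [hm2 i])
        linarith) (hms.mul_left (1 / 2))
  simp only [entFun]
  rw [entTerm, entW2Sq, htr, hdet, tsum_mul_left, hms.tsum_sub hlog]
  ring

/-- The interaction term of `A` and `B = J J*` in terms of the eigenvalues of `J* A J`. -/
theorem entTerm_of_factorization {H₁ ι : Type*} [NormedAddCommGroup H₁] [InnerProductSpace ℝ H₁]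
    [CompleteSpace H₁] {A B : H →L[ℝ] H} (hA : A.IsPositive) (hAc : IsCompactOperator A)
    {J : H₁ →L[ℝ] H} (hB : B = J ∘L ContinuousLinearMap.adjoint J) (v : HilbertBasis ι ℝ H₁) {c : ι → ℝ} (hs : Summable c)
    (hv : ∀ i, (ContinuousLinearMap.adjoint J ∘L A ∘L J) (v i) = c i • v i) (ε : ℝ) :
    entTerm ε A B = -∑' i, entFun ε (c i) := by
  classical
  obtain ⟨hQ, hQQ⟩ := opSqrt_spec_of_isCompactOperator hA hAc
  set Q := opSqrt A
  -- `S* S = J* A J` and `S S* = A^{1/2} B A^{1/2}`, so `S` carries eigenvectors of the first to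
  -- eigenvectors of the second, with the same nonzero eigenvalues and with `‖S (v i)‖ = √(c i)`.
  let S : H₁ →L[ℝ] H := Q ∘L J
  have hSS : ∀ x y, ⟪S x, S y⟫_ℝ = ⟪x, (ContinuousLinearMap.adjoint J ∘L A ∘L J) y⟫_ℝ := fun x y => by
    change ⟪Q (J x), Q (J y)⟫_ℝ = ⟪x, ContinuousLinearMap.adjoint J (A (J y))⟫_ℝ
    rw [hQ.inner_left_eq_inner_right, ContinuousLinearMap.adjoint_inner_right, ← hQQ]
    rfl
  have hSv : ∀ i j, ⟪S (v i), S (v j)⟫_ℝ = c j * ⟪v i, v j⟫_ℝ := fun i j => by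
    rw [hSS, hv, inner_smul_right]
  have hc : ∀ i, 0 ≤ c i := fun i => by
    have := hSv i i
    rw [real_inner_self_eq_norm_sq, real_inner_self_eq_norm_sq, v.orthonormal.1 i, one_pow,
      mul_one] at this
    rw [← this]
    positivity
  let I := {i // c i ≠ 0}
  let e : I → H := fun i => (√(c i))⁻¹ • S (v i)
  have hpos : ∀ i : I, 0 < √(c i) := fun i => Real.sqrt_pos.2 ((hc i).lt_of_ne' i.2)
  have he : Orthonormal ℝ e := by
    rw [orthonormal_iff_ite]
    intro i j
    simp only [e, inner_smul_left, inner_smul_right, hSv, orthonormal_iff_ite.1 v.orthonormal,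
      Subtype.coe_inj]
    split_ifs with hij
    · subst hij
      have h1 := Real.mul_self_sqrt (hc i)
      have h2 := (hpos i).ne'
      simp only [conj_trivial, mul_one]
      field_simp
      rw [sq, h1]
    · simp
  have hC : ∀ x, (Q ∘L B ∘L Q) x = S (ContinuousLinearMap.adjoint S x) := fun x => by
    have : ContinuousLinearMap.adjoint S = ContinuousLinearMap.adjoint J ∘L Q := by
      rw [ContinuousLinearMap.adjoint_comp, hQ.isSelfAdjoint.adjoint_eq]
    rw [this, hB]
    rfl
  have hSadj : ∀ i, ContinuousLinearMap.adjoint S (S (v i)) = c i • v i := fun i => by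
    refine ext_inner_left ℝ fun x => ?_
    rw [ContinuousLinearMap.adjoint_inner_right, hSS, hv]
  have hCe : ∀ i : I, (Q ∘L B ∘L Q) (e i) = c i • e i := fun i => by
    rw [hC]
    simp only [e, map_smul, hSadj, smul_comm (c i)]
  -- Vectors orthogonal to all `e i` lie in the kernel of `S*`, so no other nonzero eigenvalue
  -- occurs.
  have hCperp : ∀ x, (∀ i, ⟪e i, x⟫_ℝ = 0) → (Q ∘L B ∘L Q) x = 0 := fun x hx => by
    have h0 : ∀ i, ⟪v i, ContinuousLinearMap.adjoint S x⟫_ℝ = 0 := fun i => by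
      rw [ContinuousLinearMap.adjoint_inner_right]
      by_cases hi : c i = 0
      · have := hSv i i
        rw [hi, zero_mul, inner_self_eq_zero] at this
        rw [this, inner_zero_left]
      · have := hx ⟨i, hi⟩
        simp only [e, inner_smul_left, conj_trivial] at this
        exact (mul_eq_zero.1 this).resolve_left (inv_ne_zero (hpos ⟨i, hi⟩).ne')
    have h1 := v.hasSum_inner_sq (ContinuousLinearMap.adjoint S x)
    simp only [h0] at h1
    have h2 : ‖ContinuousLinearMap.adjoint S x‖ ^ 2 = 0 := h1.unique (by simp [hasSum_zero])
    have h3 : ContinuousLinearMap.adjoint S x = 0 := by simpa using h2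
    rw [hC, h3, map_zero]
  have hinj : Function.Injective e := he.linearIndependent.injective
  obtain ⟨w, b, hw, hb⟩ := he.toSubtypeRange.exists_hilbertBasis_extension
  let f : I → w := fun i => ⟨e i, hw ⟨i, rfl⟩⟩
  have hf : Function.Injective f := fun i j hij => hinj (congrArg Subtype.val hij)
  -- The vectors added to complete `e` to a basis get eigenvalue `0`; they are harmless since
  -- `entFun ε 0 = 0`.
  let γ : w → ℝ := Function.extend f (fun i => c i) 0
  have hγf : ∀ i, γ (f i) = c i := fun i => hf.extend_apply _ _ i
  have hγ0 : ∀ x, x ∉ Set.range f → γ x = 0 := fun x hx => by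
    simp only [γ]
    rw [Function.extend_apply' _ _ _ (by simpa using hx)]
    rfl
  have hdiag : ∀ x, (Q ∘L B ∘L Q) (b x) = γ x • b x := fun x => by
    by_cases hx : x ∈ Set.range f
    · obtain ⟨i, rfl⟩ := hx
      rw [hγf, hb]
      exact hCe i
    · rw [hγ0 x hx, zero_smul]
      refine hCperp _ fun i => ?_
      have h1 : e i = b (f i) := by rw [hb]
      rw [h1]
      exact b.orthonormal.2 fun h => hx ⟨i, h⟩
  have hγ : ∀ x, 0 ≤ γ x := fun x => by
    by_cases hx : x ∈ Set.range f
    · obtain ⟨i, rfl⟩ := hx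
      rw [hγf]; exact hc i
    · rw [hγ0 x hx]
  have hγs : Summable γ := by
    rw [← hf.summable_iff hγ0]
    have : γ ∘ f = c ∘ Subtype.val := funext hγf
    rw [this]
    exact hs.subtype _
  rw [entTerm_of_diagonal b hγ hγs hdiag]
  congr 1
  rw [← hf.tsum_eq (f := fun x => entFun ε (γ x))]
  · simp only [hγf]
    exact (Subtype.val_injective (p := fun i => c i ≠ 0)).tsum_eq
      (f := fun i => entFun ε (c i)) fun i hi => ⟨⟨i, fun h => hi (by simp [h, entFun_zero])⟩, rfl⟩
  · intro x hx
    by_contra h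
    exact hx (by simp [hγ0 x h, entFun_zero])

end EntropicTerm

/-! ### Peierls' inequality. -/

section Peierls

variable {H : Type u} [NormedAddCommGroup H] [InnerProductSpace ℝ H]

/-- Peierls' inequality for the concave function `entFun`: its trace at an operator is at most its
sum over the diagonal of the operator, in any Hilbert basis. -/
theorem tsum_entFun_le {ι κ : Type*} {ε : ℝ} (hε : 0 < ε) (v : HilbertBasis ι ℝ H)
    (w : HilbertBasis κ ℝ H) {K : H →L[ℝ] H} {c : ι → ℝ} (hc : ∀ i, 0 ≤ c i) (hs : Summable c)
    (hK : ∀ i, K (v i) = c i • v i) :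
    ∑' i, entFun ε (c i) ≤ ∑' j, entFun ε ⟪w j, K (w j)⟫_ℝ := by
  have ha := fun j => hasSum_inner_apply_of_diagonal v hK (w j)
  have ha0 : ∀ j, 0 ≤ ⟪w j, K (w j)⟫_ℝ := fun j =>
    (ha j).nonneg fun i => mul_nonneg (hc i) (sq_nonneg _)
  have has : Summable fun j => ⟪w j, K (w j)⟫_ℝ := by
    have := (hasSum_tsum_mul_inner_sq v w hc hs).2.summable
    simpa only [(ha _).tsum_eq] using this
  obtain ⟨h1, h2⟩ := hasSum_tsum_mul_inner_sq v w (a := fun i => entFun ε (c i))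
    (fun i => entFun_nonneg hε (hc i)) (summable_entFun hε hc hs)
  rw [← h2.tsum_eq]
  refine h2.summable.tsum_le_tsum (fun j => ?_) (summable_entFun hε ha0 has)
  set a := ⟪w j, K (w j)⟫_ℝ with haj
  have hone : HasSum (fun i => ⟪v i, w j⟫_ℝ ^ 2) 1 := by
    simpa [w.orthonormal.1 j] using v.hasSum_inner_sq (w j)
  -- Jensen's argument: the weights `⟪v i, w j⟫²` sum to `1` over `i` and average `c` to `a`, so the
  -- tangent at `a` averages to `entFun ε a`.
  have htan : HasSum (fun i => (entFun ε a + entSlope ε a * (c i - a)) * ⟪v i, w j⟫_ℝ ^ 2)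
      (entFun ε a) := by
    have h := (hone.mul_left (entFun ε a - entSlope ε a * a)).add ((ha j).mul_left (entSlope ε a))
    rw [← haj] at h
    have e : (entFun ε a - entSlope ε a * a) * 1 + entSlope ε a * a = entFun ε a := by ring
    rw [e] at h
    refine h.congr_fun fun i => ?_
    ring
  rw [← htan.tsum_eq]
  exact (h1 j).tsum_le_tsum (fun i => mul_le_mul_of_nonneg_right
    (entFun_le_tangent hε (ha0 j) (hc i)) (sq_nonneg _)) htan.summable

end Peierls

/-! ### Hilbert-Schmidt operators as tensors, and stability of the interaction term. -/

section HilbertTensor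

open scoped TensorProduct

variable {H₀ : Type*} {H₁ : Type u} [NormedAddCommGroup H₀] [InnerProductSpace ℝ H₀]
  [NormedAddCommGroup H₁] [InnerProductSpace ℝ H₁]

variable (H₀ H₁) in
/-- The Hilbert tensor product of two real inner product spaces. -/
abbrev HilbertTensor := UniformSpace.Completion (H₀ ⊗[ℝ] H₁)

/-- A pure tensor in the Hilbert tensor product. -/
def pureTensor (x : H₀) (y : H₁) : HilbertTensor H₀ H₁ := ((x ⊗ₜ[ℝ] y : H₀ ⊗[ℝ] H₁) : _)

theorem inner_pureTensor (x x' : H₀) (y y' : H₁) :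
    ⟪pureTensor x y, pureTensor x' y'⟫_ℝ = ⟪x, x'⟫_ℝ * ⟪y, y'⟫_ℝ := by
  rw [pureTensor, pureTensor, UniformSpace.Completion.inner_coe, TensorProduct.inner_tmul]

theorem norm_pureTensor (x : H₀) (y : H₁) : ‖pureTensor x y‖ = ‖x‖ * ‖y‖ := by
  rw [pureTensor, UniformSpace.Completion.norm_coe, TensorProduct.norm_tmul]

theorem continuous_pureTensor : Continuous fun p : H₀ × H₁ => pureTensor p.1 p.2 :=
  (UniformSpace.Completion.continuous_coe _).comp TensorProduct.continuous_tmul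

/-- The vector `T` of the Hilbert tensor product corresponds to the (Hilbert-Schmidt) operator
`R`. -/
def Represents (T : HilbertTensor H₀ H₁) (R : H₁ →L[ℝ] H₀) : Prop :=
  ∀ x y, ⟪x, R y⟫_ℝ = ⟪pureTensor x y, T⟫_ℝ

variable {T T' : HilbertTensor H₀ H₁} {R R' : H₁ →L[ℝ] H₀}

theorem Represents.add (h : Represents T R) (h' : Represents T' R') :
    Represents (T + T') (R + R') := fun x y => by
  rw [add_apply, inner_add_right, inner_add_right, h, h']

theorem Represents.sub (h : Represents T R) (h' : Represents T' R') :
    Represents (T - T') (R - R') := fun x y => by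
  rw [sub_apply, inner_sub_right, inner_sub_right, h, h']

variable [CompleteSpace H₀]

/-- Bessel's inequality for `T` along the orthonormal family `b i ⊗ w j`: the Hilbert-Schmidt norm
of `R` is at most `‖T‖`. -/
theorem Represents.summable_norm_sq {κ : Type*} (h : Represents T R) (w : HilbertBasis κ ℝ H₁) :
    Summable (fun j => ‖R (w j)‖ ^ 2) ∧ ∑' j, ‖R (w j)‖ ^ 2 ≤ ‖T‖ ^ 2 := by
  obtain ⟨s, b, -⟩ := exists_hilbertBasis ℝ H₀
  have hon : Orthonormal ℝ fun p : s × κ => pureTensor (b p.1) (w p.2) :=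
    (b.orthonormal.tmul w.orthonormal).comp_linearIsometry UniformSpace.Completion.toComplₗᵢ
  have h1 := hon.inner_products_summable T
  have h2 := hon.tsum_inner_products_le T
  simp only [← h (b _) (w _), Real.norm_eq_abs, sq_abs] at h1 h2
  have h3 := h1.prod_symm
  have h4 := h3.prod
  have h5 := h3.tsum_prod
  simp only [Prod.fst_swap, Prod.snd_swap, (b.hasSum_inner_sq _).tsum_eq] at h4 h5
  refine ⟨h4, ?_⟩
  rw [← h5]
  refine le_trans (le_of_eq ?_) h2
  exact (Equiv.prodComm κ s).tsum_eq fun p : s × κ => ⟪b p.1, R (w p.2)⟫_ℝ ^ 2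

theorem Represents.sum_abs_inner_le {κ : Type*} (h : Represents T R) (h' : Represents T' R')
    (w : HilbertBasis κ ℝ H₁) (F : Finset κ) :
    ∑ j ∈ F, |⟪R (w j), R' (w j)⟫_ℝ| ≤ ‖T‖ * ‖T'‖ := by
  have hF : ∀ {T : HilbertTensor H₀ H₁} {R : H₁ →L[ℝ] H₀}, Represents T R →
      √(∑ j ∈ F, ‖R (w j)‖ ^ 2) ≤ ‖T‖ := fun {T R} h => by
    rw [Real.sqrt_le_left (norm_nonneg _)]
    exact ((h.summable_norm_sq w).1.sum_le_tsum F fun _ _ => sq_nonneg _).trans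
      (h.summable_norm_sq w).2
  calc ∑ j ∈ F, |⟪R (w j), R' (w j)⟫_ℝ| ≤ ∑ j ∈ F, ‖R (w j)‖ * ‖R' (w j)‖ :=
        Finset.sum_le_sum fun j _ => abs_real_inner_le_norm _ _
    _ ≤ √(∑ j ∈ F, ‖R (w j)‖ ^ 2) * √(∑ j ∈ F, ‖R' (w j)‖ ^ 2) :=
        Real.sum_mul_le_sqrt_mul_sqrt _ _ _
    _ ≤ ‖T‖ * ‖T'‖ := mul_le_mul (hF h) (hF h') (Real.sqrt_nonneg _) (norm_nonneg _)

theorem Represents.eigenvalues {ι : Type*} (h : Represents T R) {K : H₁ →L[ℝ] H₁}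
    (hK : ∀ x y, ⟪x, K y⟫_ℝ = ⟪R x, R y⟫_ℝ) (v : HilbertBasis ι ℝ H₁) {c : ι → ℝ}
    (hv : ∀ i, K (v i) = c i • v i) : (∀ i, c i = ‖R (v i)‖ ^ 2) ∧ Summable c := by
  have hc : ∀ i, c i = ‖R (v i)‖ ^ 2 := fun i => by
    rw [← real_inner_self_eq_norm_sq, ← hK, hv, inner_smul_right, real_inner_self_eq_norm_sq,
      v.orthonormal.1 i, one_pow, mul_one]
  refine ⟨hc, ?_⟩
  rw [funext hc]
  exact (h.summable_norm_sq v).1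

/-- Peierls' inequality moves the first sum to the eigenbasis `w` of `K'`. There the slope bound
applies termwise, with `‖R w‖² - ‖R' w‖² = ⟪(R - R') w, (R + R') w⟫`. -/
theorem Represents.tsum_entFun_sub_le {ι κ : Type*} {ε : ℝ} (hε : 0 < ε) (h : Represents T R)
    (h' : Represents T' R') {K K' : H₁ →L[ℝ] H₁} (hK : ∀ x y, ⟪x, K y⟫_ℝ = ⟪R x, R y⟫_ℝ)
    (hK' : ∀ x y, ⟪x, K' y⟫_ℝ = ⟪R' x, R' y⟫_ℝ) (v : HilbertBasis ι ℝ H₁) {c : ι → ℝ}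
    (hv : ∀ i, K (v i) = c i • v i) (w : HilbertBasis κ ℝ H₁) {d : κ → ℝ}
    (hw : ∀ j, K' (w j) = d j • w j) :
    ∑' i, entFun ε (c i) - ∑' j, entFun ε (d j) ≤ 2 / ε * (‖T - T'‖ * ‖T + T'‖) := by
  obtain ⟨hc, hcs⟩ := h.eigenvalues hK v hv
  obtain ⟨hd, hds⟩ := h'.eigenvalues hK' w hw
  have hc0 : ∀ i, 0 ≤ c i := fun i => by rw [hc]; positivity
  have hd0 : ∀ i, 0 ≤ d i := fun i => by rw [hd]; positivity
  have h1 := tsum_entFun_le hε v w hc0 hcs hv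
  have h2 : ∀ j, ⟪w j, K (w j)⟫_ℝ = ‖R (w j)‖ ^ 2 := fun j => by
    rw [hK, real_inner_self_eq_norm_sq]
  simp only [h2] at h1
  have hs1 : Summable fun j => entFun ε (‖R (w j)‖ ^ 2) :=
    summable_entFun hε (fun j => sq_nonneg _) (h.summable_norm_sq w).1
  have hs2 : Summable fun j => entFun ε (d j) := summable_entFun hε hd0 hds
  have h3 : ∑' j, (entFun ε (‖R (w j)‖ ^ 2) - entFun ε (d j))
      ≤ 2 / ε * (‖T - T'‖ * ‖T + T'‖) := by
    refine (hs1.sub hs2).tsum_le_of_sum_le fun F => ?_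
    calc ∑ j ∈ F, (entFun ε (‖R (w j)‖ ^ 2) - entFun ε (d j))
        ≤ ∑ j ∈ F, 2 / ε * |⟪(R - R') (w j), (R + R') (w j)⟫_ℝ| := by
          refine Finset.sum_le_sum fun j _ => ?_
          refine (entFun_sub_le hε (hd0 j) (sq_nonneg _)).trans (le_of_eq ?_)
          rw [sub_apply, add_apply, hd, inner_add_right, inner_sub_left, inner_sub_left,
            real_inner_self_eq_norm_sq, real_inner_self_eq_norm_sq,
            real_inner_comm (R (w j)) (R' (w j))]
          congr 2
          ring
      _ = 2 / ε * ∑ j ∈ F, |⟪(R - R') (w j), (R + R') (w j)⟫_ℝ| := by rw [Finset.mul_sum]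
      _ ≤ _ := mul_le_mul_of_nonneg_left ((h.sub h').sum_abs_inner_le (h.add h') w F)
          (by positivity)
  rw [hs1.tsum_sub hs2] at h3
  linarith

variable [CompleteSpace H₁]

open ContinuousLinearMap in
-- Takes `R = J₀* J₁` and `K = R* R`, which removes the space `E`: terms coming from different `E`
-- can then be compared inside `H₁`.
theorem exists_entTerm_eq {E : Type*} [NormedAddCommGroup E] [InnerProductSpace ℝ E]
    [CompleteSpace E] (ε : ℝ) {J₀ : H₀ →L[ℝ] E} {J₁ : H₁ →L[ℝ] E} (hc : IsCompactOperator J₀)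
    {A B : E →L[ℝ] E} (hA : A = J₀ ∘L adjoint J₀) (hB : B = J₁ ∘L adjoint J₁)
    (hT : ∀ x y, ⟪J₀ x, J₁ y⟫_ℝ = ⟪pureTensor x y, T⟫_ℝ) :
    ∃ (R : H₁ →L[ℝ] H₀) (K : H₁ →L[ℝ] H₁), Represents T R ∧
      (∀ x y, ⟪x, K y⟫_ℝ = ⟪R x, R y⟫_ℝ) ∧ ∃ (ι : Type u) (v : HilbertBasis ι ℝ H₁) (c : ι → ℝ),
      (∀ i, K (v i) = c i • v i) ∧ entTerm ε A B = -∑' i, entFun ε (c i) := by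
  have hR : Represents T (adjoint J₀ ∘L J₁) := fun x y => by
    rw [← hT, comp_apply, adjoint_inner_right]
  have hAc : IsCompactOperator A := by
    rw [hA]; exact hc.comp_clm (adjoint J₀)
  have hK : ∀ x y, ⟪x, (adjoint J₁ ∘L A ∘L J₁) y⟫_ℝ
      = ⟪(adjoint J₀ ∘L J₁) x, (adjoint J₀ ∘L J₁) y⟫_ℝ := fun x y => by
    rw [comp_apply, comp_apply, adjoint_inner_right, hA, comp_apply, comp_apply, comp_apply,
      adjoint_inner_left]
  have hKc : IsCompactOperator (adjoint J₁ ∘L A ∘L J₁) :=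
    (hAc.comp_clm J₁).clm_comp (adjoint J₁)
  have hKs : (adjoint J₁ ∘L A ∘L J₁).IsSymmetric := fun x y => by
    change ⟪(adjoint J₁ ∘L A ∘L J₁) x, y⟫_ℝ = ⟪x, (adjoint J₁ ∘L A ∘L J₁) y⟫_ℝ
    rw [real_inner_comm, hK, hK, real_inner_comm]
  obtain ⟨ι, v, c, hv⟩ := exists_hilbertBasis_eigenvectors hKc hKs
  refine ⟨_, _, hR, hK, ι, v, c, hv, ?_⟩
  have hAp : A.IsPositive := by
    rw [hA]; exact isPositive_self_comp_adjoint J₀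
  exact entTerm_of_factorization hAp hAc hB v (hR.eigenvalues hK v hv).2 hv ε

open ContinuousLinearMap in
/-- Stability of the interaction term: for `A = J₀ J₀*`, `B = J₁ J₁*` it depends Lipschitz
continuously on the Hilbert-Schmidt operator `J₀* J₁`. -/
theorem abs_entTerm_sub_le {E E' : Type*} [NormedAddCommGroup E] [InnerProductSpace ℝ E]
    [CompleteSpace E] [NormedAddCommGroup E'] [InnerProductSpace ℝ E'] [CompleteSpace E']
    {ε : ℝ} (hε : 0 < ε) {J₀ : H₀ →L[ℝ] E} {J₁ : H₁ →L[ℝ] E} {J₀' : H₀ →L[ℝ] E'}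
    {J₁' : H₁ →L[ℝ] E'} (hc : IsCompactOperator J₀) (hc' : IsCompactOperator J₀')
    {A B : E →L[ℝ] E} {A' B' : E' →L[ℝ] E'} (hA : A = J₀ ∘L adjoint J₀) (hB : B = J₁ ∘L adjoint J₁)
    (hA' : A' = J₀' ∘L adjoint J₀') (hB' : B' = J₁' ∘L adjoint J₁')
    (hT : ∀ x y, ⟪J₀ x, J₁ y⟫_ℝ = ⟪pureTensor x y, T⟫_ℝ)
    (hT' : ∀ x y, ⟪J₀' x, J₁' y⟫_ℝ = ⟪pureTensor x y, T'⟫_ℝ) :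
    |entTerm ε A B - entTerm ε A' B'| ≤ 2 / ε * (‖T - T'‖ * ‖T + T'‖) := by
  obtain ⟨R, K, hR, hK, ι, v, c, hv, he⟩ := exists_entTerm_eq ε hc hA hB hT
  obtain ⟨R', K', hR', hK', ι', v', c', hv', he'⟩ := exists_entTerm_eq ε hc' hA' hB' hT'
  rw [he, he', abs_le]
  have h1 := hR.tsum_entFun_sub_le hε hR' hK hK' v hv v' hv'
  have h2 := hR'.tsum_entFun_sub_le hε hR hK' hK v' hv' v hv
  rw [norm_sub_rev, add_comm T' T] at h2
  constructor <;> linarith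

end HilbertTensor

/-! ### Feature maps and compactness of their evaluation operators. -/

section FeatureMap

variable {α : Type u} [TopologicalSpace α]

/-- Moore-Aronszajn: a continuous covariance function is the Gram kernel of a continuous map into a
Hilbert space. -/
theorem IsCovarianceKernel.exists_featureMap {K : C(α × α, ℝ)} (hK : IsCovarianceKernel K) :
    ∃ (H : Type u) (_ : NormedAddCommGroup H) (_ : InnerProductSpace ℝ H) (_ : CompleteSpace H)
      (Φ : C(α, H)), ∀ x y, ⟪Φ x, Φ y⟫_ℝ = K (x, y) := by
  -- The reproducing kernel space is built from operator-valued kernels, so `K` is read as a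
  -- multiple of the identity of `ℝ`.
  let M : Matrix α α (ℝ →L[ℝ] ℝ) :=
    Matrix.of fun x y => K (x, y) • ContinuousLinearMap.id ℝ ℝ
  have hsymm : ∀ x y, K (x, y) = K (y, x) := fun x y => by
    simpa using (hK.isHermitian.apply y x)
  have hM : M.PosSemidef := by
    have htfae := (RKHS.posSemidef_tfae (K := M)).out 0 2
    refine htfae.2 ⟨?_, fun vv => ?_⟩
    · refine Matrix.IsHermitian.ext fun x y => ?_
      ext
      simp [M, ContinuousLinearMap.star_eq_adjoint, ContinuousLinearMap.adjoint_id, hsymm x y]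
    · refine (hK.2 vv).trans (le_of_eq ?_)
      simp only [RCLike.re_to_real]
      refine Finsupp.sum_congr fun x _ => Finsupp.sum_congr fun y _ => ?_
      simp [M, hsymm x y]
      ring
  have : Fact M.PosSemidef := ⟨hM⟩
  let φ : α → RKHS.OfKernel M := fun x => RKHS.kerFun (RKHS.OfKernel M) x 1
  have hφ : ∀ x y, ⟪φ x, φ y⟫_ℝ = K (x, y) := fun x y => by
    have h := RKHS.kernel_inner (RKHS.OfKernel M) y x (1 : ℝ) (1 : ℝ)
    rw [RKHS.OfKernel.kernel_ofKernel] at h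
    rw [← h]
    simp [M, hsymm x y]
  have hcont : Continuous φ := by
    rw [continuous_iff_continuousAt]
    intro x
    rw [ContinuousAt, tendsto_iff_norm_sub_tendsto_zero]
    have h1 : ∀ y, ‖φ y - φ x‖ = √(K (y, y) - 2 * K (y, x) + K (x, x)) := fun y => by
      rw [← hφ, ← hφ, ← hφ, real_inner_self_eq_norm_sq, real_inner_self_eq_norm_sq,
        ← norm_sub_sq_real, Real.sqrt_sq (norm_nonneg _)]
    simp only [h1]
    have h2 : Continuous fun y => √(K (y, y) - 2 * K (y, x) + K (x, x)) := by fun_prop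
    have h3 := h2.tendsto x
    have h4 : K (x, x) - 2 * K (x, x) + K (x, x) = 0 := by ring
    rwa [h4, Real.sqrt_zero] at h3
  exact ⟨RKHS.OfKernel M, inferInstance, inferInstance, inferInstance, ⟨φ, hcont⟩, hφ⟩

theorem kernelSup_nonneg (K : C(α × α, ℝ)) : 0 ≤ kernelSup K :=
  Real.iSup_nonneg fun _ => abs_nonneg _

variable [CompactSpace α]

theorem abs_le_kernelSup (K : C(α × α, ℝ)) (p : α × α) : |K p| ≤ kernelSup K :=
  le_ciSup (f := fun p => |K p|) (isCompact_range (by fun_prop)).bddAbove p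

variable {H : Type*} [NormedAddCommGroup H] [InnerProductSpace ℝ H]

/-- The functions `x ↦ ⟪Φ x, h⟫` of a continuous feature map `Φ`. -/
def featureEval (Φ : C(α, H)) : H →L[ℝ] C(α, ℝ) :=
  LinearMap.mkContinuous
    { toFun := fun h => ⟨fun x => ⟪Φ x, h⟫_ℝ, by fun_prop⟩
      map_add' := fun g h => by ext x; exact inner_add_right _ _ _
      map_smul' := fun c h => by ext x; exact inner_smul_right _ _ _ } ‖Φ‖ fun h => by
    refine (ContinuousMap.norm_le _ (by positivity)).2 fun x => ?_
    exact (norm_inner_le_norm _ _).trans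
      (mul_le_mul_of_nonneg_right (Φ.norm_coe_le_norm x) (norm_nonneg _))

@[simp]
theorem featureEval_apply (Φ : C(α, H)) (h : H) (x : α) : featureEval Φ h x = ⟪Φ x, h⟫_ℝ := rfl

/-- The range of `Φ` is compact, hence within `ε / 2` of the span of a finite net. Projecting onto
that span gives finite-rank approximations in norm, and compact operators form a closed set. -/
theorem isCompactOperator_featureEval (Φ : C(α, H)) : IsCompactOperator (featureEval Φ) := by
  have hcl := isClosed_setOfPred_isCompactOperator (σ₁₂ := RingHom.id ℝ) (M₁ := H) (M₂ := C(α, ℝ))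
  change featureEval Φ ∈ {f : H →L[ℝ] C(α, ℝ) | IsCompactOperator f}
  refine hcl.closure_subset ((Metric.mem_closure_iff (α := H →L[ℝ] C(α, ℝ))).2 fun ε hε => ?_)
  have htb : TotallyBounded (Set.range Φ) := (isCompact_range Φ.continuous).totallyBounded
  obtain ⟨t, ht, hcov⟩ := Metric.totallyBounded_iff.1 htb (ε / 2) (half_pos hε)
  let V : Submodule ℝ H := Submodule.span ℝ t
  have : FiniteDimensional ℝ V := FiniteDimensional.span_of_finite ℝ ht
  let P : H →L[ℝ] H := V.subtypeL ∘L V.orthogonalProjectionOnto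
  have hPs : ∀ x y, ⟪x, P y⟫_ℝ = ⟪P x, y⟫_ℝ := fun x y =>
    (V.inner_starProjection_left_eq_right x y).symm
  have hP : ∀ x, ‖Φ x - P (Φ x)‖ ≤ ε / 2 := fun x => by
    obtain ⟨y, hy, hxy⟩ := Set.mem_iUnion₂.1 (hcov ⟨x, rfl⟩)
    rw [Metric.mem_ball, dist_eq_norm] at hxy
    refine le_trans ?_ hxy.le
    have h1 : ‖Φ x - P (Φ x)‖ = ⨅ z : V, ‖Φ x - z‖ := V.starProjection_minimal (Φ x)
    rw [h1]
    exact ciInf_le ⟨0, by rintro _ ⟨z, rfl⟩; exact norm_nonneg _⟩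
      (⟨y, Submodule.subset_span hy⟩ : V)
  refine ⟨featureEval Φ ∘L P, ?_, ?_⟩
  · have h1 : IsCompactOperator V.orthogonalProjectionOnto :=
      isCompactOperator_of_locallyCompactSpace_dom V.orthogonalProjectionOnto
    exact h1.clm_comp (featureEval Φ ∘L V.subtypeL)
  · refine (dist_eq_norm (featureEval Φ) (featureEval Φ ∘L P)).trans_lt ?_
    refine lt_of_le_of_lt ?_ (half_lt_self hε)
    refine ContinuousLinearMap.opNorm_le_bound _ (by positivity) fun h => ?_
    refine (ContinuousMap.norm_le _ (by positivity)).2 fun x => ?_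
    have h1 : (featureEval Φ - featureEval Φ ∘L P) h x = ⟪Φ x - P (Φ x), h⟫_ℝ := by
      rw [inner_sub_left, ← hPs]
      rfl
    rw [h1]
    exact (norm_inner_le_norm _ _).trans (mul_le_mul_of_nonneg_right (hP x) (norm_nonneg _))

end FeatureMap

/-! ### Factorization of the population and sample covariance operators. -/

section Representation

open ContinuousLinearMap

variable {α : Type*} [TopologicalSpace α]
  {H : Type*} [NormedAddCommGroup H] [InnerProductSpace ℝ H]
  {H₀ : Type*} [NormedAddCommGroup H₀] [InnerProductSpace ℝ H₀]
  {H₁ : Type*} [NormedAddCommGroup H₁] [InnerProductSpace ℝ H₁]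

/-- The continuous map `x ↦ Φ₀ x ⊗ Φ₁ x`. -/
def tensorFeature (Φ₀ : C(α, H₀)) (Φ₁ : C(α, H₁)) : C(α, HilbertTensor H₀ H₁) :=
  ⟨fun x => pureTensor (Φ₀ x) (Φ₁ x),
    continuous_pureTensor.comp (Φ₀.continuous.prodMk Φ₁.continuous)⟩

/-- Evaluation at the points of a sample, normalized so that the Gram operator is `empMatrix`. -/
def empEval {n : ℕ} (Φ : C(α, H)) (x : Fin n → α) : H →L[ℝ] EuclideanSpace ℝ (Fin n) :=
  (EuclideanSpace.equiv (Fin n) ℝ).symm ∘L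
    ContinuousLinearMap.pi fun k => (√n)⁻¹ • innerSL ℝ (Φ (x k))

theorem empEval_apply {n : ℕ} (Φ : C(α, H)) (x : Fin n → α) (h : H) (k : Fin n) :
    empEval Φ x h k = (√n)⁻¹ * ⟪Φ (x k), h⟫_ℝ := rfl

theorem inner_empEval {n : ℕ} (Φ₀ : C(α, H₀)) (Φ₁ : C(α, H₁)) (x : Fin n → α) (g : H₀) (h : H₁) :
    ⟪empEval Φ₀ x g, empEval Φ₁ x h⟫_ℝ
      = ⟪pureTensor g h, (n : ℝ)⁻¹ • ∑ k, tensorFeature Φ₀ Φ₁ (x k)⟫_ℝ := by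
  rw [PiLp.inner_apply, inner_smul_right, inner_sum, Finset.mul_sum]
  refine Finset.sum_congr rfl fun k _ => ?_
  have hn : (√(n : ℝ))⁻¹ * (√(n : ℝ))⁻¹ = (n : ℝ)⁻¹ := by
    rw [← mul_inv, Real.mul_self_sqrt (Nat.cast_nonneg n)]
  change empEval Φ₁ x h k * empEval Φ₀ x g k
    = (n : ℝ)⁻¹ * ⟪pureTensor g h, pureTensor (Φ₀ (x k)) (Φ₁ (x k))⟫_ℝ
  rw [empEval_apply, empEval_apply, inner_pureTensor, real_inner_comm g, real_inner_comm h, ← hn]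
  ring

theorem toEuclideanCLM_empMatrix [CompleteSpace H] {n : ℕ} {K : C(α × α, ℝ)} {Φ : C(α, H)}
    (hΦ : ∀ x y, ⟪Φ x, Φ y⟫_ℝ = K (x, y)) (x : Fin n → α) :
    Matrix.toEuclideanCLM (𝕜 := ℝ) (empMatrix K x) = empEval Φ x ∘L adjoint (empEval Φ x) := by
  ext v k
  rw [comp_apply, empEval_apply, adjoint_inner_right, PiLp.inner_apply, Matrix.ofLp_toEuclideanCLM,
    Matrix.mulVec, dotProduct, Finset.mul_sum]
  refine Finset.sum_congr rfl fun j _ => ?_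
  have hn : (√(n : ℝ))⁻¹ * (√(n : ℝ))⁻¹ = (n : ℝ)⁻¹ := by
    rw [← mul_inv, Real.mul_self_sqrt (Nat.cast_nonneg n)]
  change 1 / (n : ℝ) * K (x k, x j) * v j = (√(n : ℝ))⁻¹ * (v j * empEval Φ x (Φ (x k)) j)
  rw [empEval_apply, real_inner_comm, hΦ, one_div, ← hn]
  ring

variable [CompactSpace α] [MeasurableSpace α] [BorelSpace α] (ρ : Measure α) [IsFiniteMeasure ρ]

/-- The embedding `h ↦ ⟪Φ ·, h⟫` of the feature space in `L²(ρ)`. -/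
def l2Eval (Φ : C(α, H)) : H →L[ℝ] Lp ℝ 2 ρ := ContinuousMap.toLp 2 ρ ℝ ∘L featureEval Φ

theorem isCompactOperator_l2Eval (Φ : C(α, H)) : IsCompactOperator (l2Eval ρ Φ) :=
  (isCompactOperator_featureEval Φ).clm_comp (ContinuousMap.toLp 2 ρ ℝ)

theorem covOperator_eq [CompleteSpace H] {K : C(α × α, ℝ)} {Φ : C(α, H)}
    (hΦ : ∀ x y, ⟪Φ x, Φ y⟫_ℝ = K (x, y)) :
    covOperator ρ K = l2Eval ρ Φ ∘L adjoint (l2Eval ρ Φ) := by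
  ext1 φ
  change ContinuousMap.toLp 2 ρ ℝ (kernelIntegral ρ K φ)
    = ContinuousMap.toLp 2 ρ ℝ (featureEval Φ (adjoint (l2Eval ρ Φ) φ))
  congr 1
  ext x
  rw [featureEval_apply, adjoint_inner_right]
  refine (integral_kernel_mul ρ K φ x).trans ?_
  congr 1
  change ContinuousMap.toLp 2 ρ ℝ (K.curry x) = ContinuousMap.toLp 2 ρ ℝ (featureEval Φ (Φ x))
  congr 1
  ext y
  rw [featureEval_apply, real_inner_comm, hΦ]
  rfl

/-- Population counterpart of `inner_empEval`: both cross operators are represented by a mean of the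
same map `Φ₀ ⊗ Φ₁`. -/
theorem inner_l2Eval [SecondCountableTopology α] (Φ₀ : C(α, H₀)) (Φ₁ : C(α, H₁)) (g : H₀)
    (h : H₁) :
    ⟪l2Eval ρ Φ₀ g, l2Eval ρ Φ₁ h⟫_ℝ
      = ⟪pureTensor g h, ∫ x, tensorFeature Φ₀ Φ₁ x ∂ρ⟫_ℝ := by
  have hi : Integrable (tensorFeature Φ₀ Φ₁) ρ :=
    (tensorFeature Φ₀ Φ₁).continuous.integrable_of_hasCompactSupport
      (HasCompactSupport.of_compactSpace _)
  rw [← integral_inner hi]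
  refine (ContinuousMap.inner_toLp ρ _ _).trans (integral_congr_ae (.of_forall fun x => ?_))
  change ⟪Φ₁ x, h⟫_ℝ * ⟪Φ₀ x, g⟫_ℝ = ⟪pureTensor g h, pureTensor (Φ₀ x) (Φ₁ x)⟫_ℝ
  rw [inner_pureTensor, real_inner_comm, mul_comm, real_inner_comm]

end Representation

/-! ### Law of large numbers in a Hilbert space. -/

section EmpiricalMean

variable {α : Type*} [TopologicalSpace α] {L : Type*} [NormedAddCommGroup L]
  [InnerProductSpace ℝ L]

/-- The mean of `Ψ` over a sample of `n` points. -/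
def empMean {n : ℕ} (Ψ : C(α, L)) (x : Fin n → α) : L := (n : ℝ)⁻¹ • ∑ k, Ψ (x k)

theorem continuous_empMean {n : ℕ} (Ψ : C(α, L)) :
    Continuous fun x : Fin n → α => empMean Ψ x := by
  unfold empMean
  fun_prop

theorem norm_empMean_le {n : ℕ} {Ψ : C(α, L)} {s : ℝ} (hs : ∀ x, ‖Ψ x‖ ≤ s)
    (hn : 0 < n) (x : Fin n → α) : ‖empMean Ψ x‖ ≤ s := by
  have hn' : (0 : ℝ) < n := Nat.cast_pos.2 hn
  rw [empMean, norm_smul, norm_inv, Real.norm_natCast, inv_mul_le_iff₀ hn']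
  refine (norm_sum_le_of_le _ fun k _ => hs (x k)).trans (le_of_eq ?_)
  simp

variable [CompactSpace α] [MeasurableSpace α] [BorelSpace α] [SecondCountableTopology α]
  {Ω : Type*} [MeasurableSpace Ω] {P : Measure Ω} [IsProbabilityMeasure P]

theorem integrable_continuous_comp {F : Type*} [NormedAddCommGroup F] {β : Type*}
    [TopologicalSpace β] [CompactSpace β] [MeasurableSpace β] [BorelSpace β]
    [SecondCountableTopology β] {f : β → F} (hf : Continuous f) {X : Ω → β}
    (hX : AEMeasurable X P) : Integrable (fun ω => f (X ω)) P := by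
  have := Measure.isProbabilityMeasure_map hX
  exact (hf.integrable_of_hasCompactSupport (μ := P.map X)
    (HasCompactSupport.of_compactSpace _)).comp_aemeasurable hX

variable [CompleteSpace L] {ρ : Measure α} [IsProbabilityMeasure ρ] {n : ℕ} {x : Fin n → Ω → α}

/-- The mean square error of the empirical mean of independent, identically distributed, bounded
vectors of a Hilbert space. -/
theorem integral_norm_sq_empMean_sub_le (Ψ : C(α, L)) {s : ℝ} (hs : ∀ x, ‖Ψ x‖ ≤ s)
    (hlaw : ∀ i, HasLaw (x i) ρ P) (hindep : iIndepFun x P) (hn : 0 < n) :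
    ∫ ω, ‖(∫ y, Ψ y ∂ρ) - empMean Ψ (fun i => x i ω)‖ ^ 2 ∂P ≤ s ^ 2 / n := by
  set m := ∫ y, Ψ y ∂ρ with hm
  have hn' : (0 : ℝ) < n := Nat.cast_pos.2 hn
  have hΨi : Integrable Ψ ρ :=
    Ψ.continuous.integrable_of_hasCompactSupport (HasCompactSupport.of_compactSpace _)
  let Θ : C(α, L) := ⟨fun y => Ψ y - m, by fun_prop⟩
  have hΘi : Integrable Θ ρ :=
    Θ.continuous.integrable_of_hasCompactSupport (HasCompactSupport.of_compactSpace _)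
  have hΘ0 : ∫ y, Θ y ∂ρ = 0 := by
    change ∫ y, (Ψ y - m) ∂ρ = 0
    rw [integral_sub hΨi (integrable_const _), integral_const, ← hm]
    simp
  have hcont : Continuous fun p : α × α => ⟪Θ p.1, Θ p.2⟫_ℝ := by fun_prop
  have hpair : ∀ k l, AEMeasurable (fun ω => (x k ω, x l ω)) P := fun k l =>
    (hlaw k).aemeasurable.prodMk (hlaw l).aemeasurable
  have hint : ∀ k l, Integrable (fun ω => ⟪Θ (x k ω), Θ (x l ω)⟫_ℝ) P := fun k l =>
    integrable_continuous_comp hcont (hpair k l)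
  -- Independence turns the joint law into `ρ ⊗ ρ`, and `Θ` is centred.
  have hoff : ∀ k l, k ≠ l → ∫ ω, ⟪Θ (x k ω), Θ (x l ω)⟫_ℝ ∂P = 0 := fun k l hkl => by
    have h1 := integral_map (hpair k l) (f := fun p : α × α => ⟪Θ p.1, Θ p.2⟫_ℝ)
      hcont.aestronglyMeasurable
    rw [(hindep.indepFun hkl).map_prod_eq_prod_map_map (hlaw k).aemeasurable
      (hlaw l).aemeasurable, (hlaw k).map_eq, (hlaw l).map_eq] at h1
    rw [← h1, integral_prod _ (hcont.integrable_of_hasCompactSupport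
      (HasCompactSupport.of_compactSpace _))]
    simp only [integral_inner hΘi, hΘ0, inner_zero_right, integral_zero]
  have hdiag : ∀ k, ∫ ω, ⟪Θ (x k ω), Θ (x k ω)⟫_ℝ ∂P ≤ s ^ 2 := fun k => by
    have h1 := (hlaw k).integral_comp (f := fun y => ⟪Θ y, Θ y⟫_ℝ)
      (by fun_prop : Continuous fun y => ⟪Θ y, Θ y⟫_ℝ).aestronglyMeasurable
    -- Expands `‖Θ + m‖² ≤ s²` and drops `‖m‖²`; the cross term integrates to zero.
    have h2 : ∀ y, ⟪Θ y, Θ y⟫_ℝ ≤ s ^ 2 - 2 * ⟪m, Θ y⟫_ℝ := fun y => by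
      have h3 : Ψ y = Θ y + m := (sub_add_cancel _ _).symm
      have h4 := hs y
      have h5 : ‖Ψ y‖ ^ 2 ≤ s ^ 2 := pow_le_pow_left₀ (norm_nonneg _) h4 2
      rw [h3, norm_add_sq_real, ← real_inner_self_eq_norm_sq, real_inner_comm m] at h5
      nlinarith [sq_nonneg ‖m‖]
    have hmi : Integrable (fun y => ⟪m, Θ y⟫_ℝ) ρ := hΘi.const_inner m
    change ∫ ω, ((fun y => ⟪Θ y, Θ y⟫_ℝ) ∘ x k) ω ∂P ≤ s ^ 2
    rw [h1]
    calc ∫ y, ⟪Θ y, Θ y⟫_ℝ ∂ρ ≤ ∫ y, (s ^ 2 - 2 * ⟪m, Θ y⟫_ℝ) ∂ρ :=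
          integral_mono ((by fun_prop : Continuous fun y => ⟪Θ y, Θ y⟫_ℝ).integrable_of_hasCompactSupport
            (HasCompactSupport.of_compactSpace _)) ((integrable_const _).sub (hmi.const_mul 2)) h2
      _ = s ^ 2 := by
          rw [integral_sub (integrable_const _) (hmi.const_mul 2), integral_const_mul,
            integral_inner hΘi, hΘ0, integral_const]
          simp
  have hexp : ∀ ω, ‖m - empMean Ψ (fun i => x i ω)‖ ^ 2
      = (n : ℝ)⁻¹ ^ 2 * ∑ k, ∑ l, ⟪Θ (x k ω), Θ (x l ω)⟫_ℝ := fun ω => by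
    have h1 : empMean Ψ (fun i => x i ω) - m = (n : ℝ)⁻¹ • ∑ k, Θ (x k ω) := by
      change _ = (n : ℝ)⁻¹ • ∑ k, (Ψ (x k ω) - m)
      rw [Finset.sum_sub_distrib, Finset.sum_const, Finset.card_univ, Fintype.card_fin, smul_sub,
        ← Nat.cast_smul_eq_nsmul ℝ, smul_smul, inv_mul_cancel₀ hn'.ne', one_smul]
      rfl
    rw [norm_sub_rev, h1, norm_smul, mul_pow, Real.norm_eq_abs, sq_abs,
      ← real_inner_self_eq_norm_sq, sum_inner]
    simp only [inner_sum]
  simp only [hexp]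
  rw [integral_const_mul, integral_finsetSum _ fun k _ => integrable_finsetSum _ fun l _ => hint k l]
  have h6 : ∀ k, ∫ ω, ∑ l, ⟪Θ (x k ω), Θ (x l ω)⟫_ℝ ∂P ≤ s ^ 2 := fun k => by
    rw [integral_finsetSum _ fun l _ => hint k l,
      Finset.sum_eq_single k (fun l _ hl => hoff k l hl.symm) (by simp)]
    exact hdiag k
  calc (n : ℝ)⁻¹ ^ 2 * ∑ k, ∫ ω, ∑ l, ⟪Θ (x k ω), Θ (x l ω)⟫_ℝ ∂P
      ≤ (n : ℝ)⁻¹ ^ 2 * ∑ _k : Fin n, s ^ 2 :=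
        mul_le_mul_of_nonneg_left (Finset.sum_le_sum fun k _ => h6 k) (by positivity)
    _ = s ^ 2 / n := by
        rw [Finset.sum_const, Finset.card_univ, Fintype.card_fin, nsmul_eq_mul]
        field_simp

theorem integral_norm_empMean_sub_le (Ψ : C(α, L)) {s : ℝ} (hs0 : 0 ≤ s) (hs : ∀ x, ‖Ψ x‖ ≤ s)
    (hlaw : ∀ i, HasLaw (x i) ρ P) (hindep : iIndepFun x P) (hn : 0 < n) :
    ∫ ω, ‖(∫ y, Ψ y ∂ρ) - empMean Ψ (fun i => x i ω)‖ ∂P ≤ s / √n := by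
  set Z : Ω → ℝ := fun ω => ‖(∫ y, Ψ y ∂ρ) - empMean Ψ (fun i => x i ω)‖
  have hx : AEMeasurable (fun ω i => x i ω) P := aemeasurable_pi_lambda _ fun i =>
    (hlaw i).aemeasurable
  have hmean := continuous_empMean (n := n) Ψ
  have hc : Continuous fun y : Fin n → α => ‖(∫ y, Ψ y ∂ρ) - empMean Ψ y‖ := by fun_prop
  have h1 : Integrable Z P := integrable_continuous_comp hc hx
  have h2 : Integrable (fun ω => Z ω ^ 2) P := integrable_continuous_comp (hc.pow 2) hx
  -- Nonnegativity of the variance bounds the squared first moment by the second moment.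
  have h3 : 0 ≤ ∫ ω, (Z ω - ∫ ω', Z ω' ∂P) ^ 2 ∂P := integral_nonneg fun _ => sq_nonneg _
  have h4 : ∫ ω, (Z ω - ∫ ω', Z ω' ∂P) ^ 2 ∂P = ∫ ω, Z ω ^ 2 ∂P - (∫ ω, Z ω ∂P) ^ 2 := by
    generalize hc : ∫ ω', Z ω' ∂P = c
    have h5 : ∀ ω, (Z ω - c) ^ 2 = Z ω ^ 2 - (2 * c) * Z ω + c ^ 2 := fun ω => by ring
    simp only [h5]
    have h6 : Integrable (fun ω => 2 * c * Z ω) P := h1.const_mul _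
    have h7 : Integrable (fun ω => Z ω ^ 2 - 2 * c * Z ω) P := h2.sub h6
    rw [integral_add h7 (integrable_const _), integral_sub h2 h6, integral_const_mul, hc, integral_const]
    simp
    ring
  have h6 := integral_norm_sq_empMean_sub_le Ψ hs hlaw hindep hn
  refine abs_le_of_sq_le_sq' ?_ (by positivity) |>.2
  rw [div_pow, Real.sq_sqrt (Nat.cast_nonneg n)]
  linarith

end EmpiricalMean

/-! ### Expected error of one interaction term. -/

section Estimator

variable {α : Type*} [TopologicalSpace α]
  {H₀ H₁ : Type*} [NormedAddCommGroup H₀] [InnerProductSpace ℝ H₀] [CompleteSpace H₀]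
  [NormedAddCommGroup H₁] [InnerProductSpace ℝ H₁] [CompleteSpace H₁]
  {K₀ K₁ : C(α × α, ℝ)} {Φ₀ : C(α, H₀)} {Φ₁ : C(α, H₁)} {ε : ℝ}

/-- The interaction term of the empirical covariance matrices. -/
def empTerm (ε : ℝ) (K₀ K₁ : C(α × α, ℝ)) {n : ℕ} (y : Fin n → α) : ℝ :=
  entTerm ε (Matrix.toEuclideanCLM (𝕜 := ℝ) (empMatrix K₀ y))
    (Matrix.toEuclideanCLM (𝕜 := ℝ) (empMatrix K₁ y))

theorem empSinkhorn2_eq_empTerm (ε : ℝ) (K₀ K₁ : C(α × α, ℝ)) {n : ℕ} (y : Fin n → α) :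
    empSinkhorn2 ε K₀ K₁ y
      = empTerm ε K₀ K₁ y - 1 / 2 * (empTerm ε K₀ K₀ y + empTerm ε K₁ K₁ y) :=
  sinkhorn2_eq_entTerm _ _ _

/-- Stability is applied to two samples of the same size. Continuity in the sample supplies the
measurability and integrability of the estimator. -/
theorem continuous_empTerm (hε : 0 < ε) (h₀ : ∀ x y, ⟪Φ₀ x, Φ₀ y⟫_ℝ = K₀ (x, y))
    (h₁ : ∀ x y, ⟪Φ₁ x, Φ₁ y⟫_ℝ = K₁ (x, y)) {n : ℕ} :
    Continuous fun y : Fin n → α => empTerm ε K₀ K₁ y := by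
  rw [continuous_iff_continuousAt]
  intro y
  have hm := continuous_empMean (n := n) (tensorFeature Φ₀ Φ₁)
  have hcomp : ∀ z : Fin n → α, IsCompactOperator (empEval Φ₀ z) := fun z =>
    isCompactOperator_of_locallyCompactSpace_dom (empEval Φ₀ z)
  have hb : ∀ z : Fin n → α, dist (empTerm ε K₀ K₁ z) (empTerm ε K₀ K₁ y)
      ≤ 2 / ε * (‖empMean (tensorFeature Φ₀ Φ₁) z - empMean (tensorFeature Φ₀ Φ₁) y‖
        * ‖empMean (tensorFeature Φ₀ Φ₁) z + empMean (tensorFeature Φ₀ Φ₁) y‖) := fun z =>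
    abs_entTerm_sub_le hε (hcomp z) (hcomp y) (toEuclideanCLM_empMatrix h₀ z)
      (toEuclideanCLM_empMatrix h₁ z) (toEuclideanCLM_empMatrix h₀ y)
      (toEuclideanCLM_empMatrix h₁ y) (inner_empEval Φ₀ Φ₁ z) (inner_empEval Φ₀ Φ₁ y)
  rw [ContinuousAt, tendsto_iff_dist_tendsto_zero]
  refine squeeze_zero (fun _ => dist_nonneg) hb ?_
  have hc : Continuous fun z : Fin n → α =>
      2 / ε * (‖empMean (tensorFeature Φ₀ Φ₁) z - empMean (tensorFeature Φ₀ Φ₁) y‖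
        * ‖empMean (tensorFeature Φ₀ Φ₁) z + empMean (tensorFeature Φ₀ Φ₁) y‖) := by fun_prop
  simpa using hc.tendsto y

variable [CompactSpace α] [MeasurableSpace α] [BorelSpace α] [SecondCountableTopology α]
  {Ω : Type*} [MeasurableSpace Ω] {P : Measure Ω} [IsProbabilityMeasure P]
  {ρ : Measure α} [IsProbabilityMeasure ρ] {n : ℕ} {x : Fin n → Ω → α}

theorem integral_abs_entTerm_sub_empTerm_le (hε : 0 < ε)
    (h₀ : ∀ x y, ⟪Φ₀ x, Φ₀ y⟫_ℝ = K₀ (x, y)) (h₁ : ∀ x y, ⟪Φ₁ x, Φ₁ y⟫_ℝ = K₁ (x, y))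
    (hlaw : ∀ i, HasLaw (x i) ρ P) (hindep : iIndepFun x P) (hn : 0 < n) :
    Integrable (fun ω => entTerm ε (covOperator ρ K₀) (covOperator ρ K₁)
        - empTerm ε K₀ K₁ fun i => x i ω) P ∧
      ∫ ω, |entTerm ε (covOperator ρ K₀) (covOperator ρ K₁)
        - empTerm ε K₀ K₁ fun i => x i ω| ∂P ≤ 4 * (kernelSup K₀ * kernelSup K₁) / (ε * √n) := by
  have hx : AEMeasurable (fun ω i => x i ω) P := aemeasurable_pi_lambda _ fun i =>
    (hlaw i).aemeasurable
  have hi : Integrable (fun ω => entTerm ε (covOperator ρ K₀) (covOperator ρ K₁)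
      - empTerm ε K₀ K₁ fun i => x i ω) P :=
    (integrable_const _).sub (integrable_continuous_comp (continuous_empTerm hε h₀ h₁) hx)
  refine ⟨hi, ?_⟩
  set Ψ := tensorFeature Φ₀ Φ₁
  have hk₀ := kernelSup_nonneg K₀
  have hk₁ := kernelSup_nonneg K₁
  -- `‖Φ₀ y ⊗ Φ₁ y‖² = K₀(y, y) K₁(y, y) ≤ s²`. Both means then have norm at most `s`, so the
  -- constant is `(2/ε) · 2s · s/√n`.
  set s := √(kernelSup K₀) * √(kernelSup K₁) with hs
  have hss : s * s = kernelSup K₀ * kernelSup K₁ := by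
    rw [hs, mul_mul_mul_comm, Real.mul_self_sqrt hk₀, Real.mul_self_sqrt hk₁]
  have hs0 : 0 ≤ s := by positivity
  have hΨs : ∀ y, ‖Ψ y‖ ≤ s := fun y => by
    change ‖pureTensor (Φ₀ y) (Φ₁ y)‖ ≤ s
    rw [norm_pureTensor]
    refine mul_le_mul (Real.le_sqrt_of_sq_le ?_) (Real.le_sqrt_of_sq_le ?_) (norm_nonneg _)
      (Real.sqrt_nonneg _)
    · rw [← real_inner_self_eq_norm_sq, h₀]
      exact (le_abs_self _).trans (abs_le_kernelSup _ _)
    · rw [← real_inner_self_eq_norm_sq, h₁]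
      exact (le_abs_self _).trans (abs_le_kernelSup _ _)
  have hm : ‖∫ y, Ψ y ∂ρ‖ ≤ s := by
    simpa using norm_integral_le_of_norm_le_const (μ := ρ) (.of_forall hΨs)
  have hb : ∀ ω, |entTerm ε (covOperator ρ K₀) (covOperator ρ K₁)
      - empTerm ε K₀ K₁ fun i => x i ω|
      ≤ 4 * s / ε * ‖(∫ y, Ψ y ∂ρ) - empMean Ψ (fun i => x i ω)‖ := fun ω => by
    have h := abs_entTerm_sub_le hε (isCompactOperator_l2Eval ρ Φ₀)
      (isCompactOperator_of_locallyCompactSpace_dom (empEval Φ₀ fun i => x i ω))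
      (covOperator_eq ρ h₀) (covOperator_eq ρ h₁) (toEuclideanCLM_empMatrix h₀ _)
      (toEuclideanCLM_empMatrix h₁ fun i => x i ω) (inner_l2Eval ρ Φ₀ Φ₁)
      (inner_empEval Φ₀ Φ₁ fun i => x i ω)
    refine h.trans ?_
    have h2 : ‖(∫ y, Ψ y ∂ρ) + empMean Ψ (fun i => x i ω)‖ ≤ 2 * s :=
      (norm_add_le _ _).trans (by linarith [norm_empMean_le hΨs hn (fun i => x i ω)])
    calc 2 / ε * (‖(∫ y, Ψ y ∂ρ) - empMean Ψ (fun i => x i ω)‖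
          * ‖(∫ y, Ψ y ∂ρ) + empMean Ψ (fun i => x i ω)‖)
        ≤ 2 / ε * (‖(∫ y, Ψ y ∂ρ) - empMean Ψ (fun i => x i ω)‖ * (2 * s)) := by gcongr
      _ = _ := by ring
  have hmean := continuous_empMean (n := n) Ψ
  have hint : Integrable (fun ω => ‖(∫ y, Ψ y ∂ρ) - empMean Ψ (fun i => x i ω)‖) P :=
    integrable_continuous_comp
      (by fun_prop : Continuous fun y : Fin n → α => ‖(∫ y, Ψ y ∂ρ) - empMean Ψ y‖) hx
  calc ∫ ω, |entTerm ε (covOperator ρ K₀) (covOperator ρ K₁)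
        - empTerm ε K₀ K₁ fun i => x i ω| ∂P
      ≤ ∫ ω, 4 * s / ε * ‖(∫ y, Ψ y ∂ρ) - empMean Ψ (fun i => x i ω)‖ ∂P :=
        integral_mono hi.abs (hint.const_mul _) hb
    _ = 4 * s / ε * ∫ ω, ‖(∫ y, Ψ y ∂ρ) - empMean Ψ (fun i => x i ω)‖ ∂P :=
        integral_const_mul _ _
    _ ≤ 4 * s / ε * (s / √n) := mul_le_mul_of_nonneg_left
        (integral_norm_empMean_sub_le Ψ hs0 hΨs hlaw hindep hn) (by positivity)
    _ = 4 * (kernelSup K₀ * kernelSup K₁) / (ε * √n) := by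
        rw [div_mul_div_comm, mul_assoc, hss]

end Estimator

end GPSinkhorn

end

/-! ### Assembly of the three interaction terms. -/

theorem mainTheorem1 {d : ℕ} (X : Set (EuclideanSpace ℝ (Fin d))) [CompactSpace X]
    (ρ : Measure X) [IsProbabilityMeasure ρ]
    (K₀ K₁ : C(X × X, ℝ))
    (hK₀ : GPSinkhorn.IsCovarianceKernel K₀) (hK₁ : GPSinkhorn.IsCovarianceKernel K₁)
    (ε : ℝ) (hε : 0 < ε) (n : ℕ) (hn : 0 < n)
    {Ω : Type*} [MeasurableSpace Ω] (P : Measure Ω) [IsProbabilityMeasure P]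
    (x : Fin n → Ω → X) (hlaw : ∀ i, HasLaw (x i) ρ P) (hindep : iIndepFun x P) :
    Integrable (fun ω =>
        |GPSinkhorn.sinkhorn2 ε (GPSinkhorn.covOperator ρ K₀) (GPSinkhorn.covOperator ρ K₁)
          - GPSinkhorn.empSinkhorn2 ε K₀ K₁ (fun i => x i ω)|) P ∧
      ∫ ω, |GPSinkhorn.sinkhorn2 ε (GPSinkhorn.covOperator ρ K₀) (GPSinkhorn.covOperator ρ K₁)
          - GPSinkhorn.empSinkhorn2 ε K₀ K₁ (fun i => x i ω)| ∂P
        ≤ 4 * (GPSinkhorn.kernelSup K₀ + GPSinkhorn.kernelSup K₁) ^ 2 / (ε * Real.sqrt n) := by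
  obtain ⟨H₀, _, _, _, Φ₀, h₀⟩ := hK₀.exists_featureMap
  obtain ⟨H₁, _, _, _, Φ₁, h₁⟩ := hK₁.exists_featureMap
  obtain ⟨i01, b01⟩ :=
    GPSinkhorn.integral_abs_entTerm_sub_empTerm_le hε h₀ h₁ hlaw hindep hn
  obtain ⟨i00, b00⟩ :=
    GPSinkhorn.integral_abs_entTerm_sub_empTerm_le hε h₀ h₀ hlaw hindep hn
  obtain ⟨i11, b11⟩ :=
    GPSinkhorn.integral_abs_entTerm_sub_empTerm_le hε h₁ h₁ hlaw hindep hn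
  set f01 : Ω → ℝ := fun ω => GPSinkhorn.entTerm ε (GPSinkhorn.covOperator ρ K₀)
    (GPSinkhorn.covOperator ρ K₁) - GPSinkhorn.empTerm ε K₀ K₁ fun i => x i ω
  set f00 : Ω → ℝ := fun ω => GPSinkhorn.entTerm ε (GPSinkhorn.covOperator ρ K₀)
    (GPSinkhorn.covOperator ρ K₀) - GPSinkhorn.empTerm ε K₀ K₀ fun i => x i ω
  set f11 : Ω → ℝ := fun ω => GPSinkhorn.entTerm ε (GPSinkhorn.covOperator ρ K₁)
    (GPSinkhorn.covOperator ρ K₁) - GPSinkhorn.empTerm ε K₁ K₁ fun i => x i ω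
  have hf : ∀ ω, GPSinkhorn.sinkhorn2 ε (GPSinkhorn.covOperator ρ K₀)
      (GPSinkhorn.covOperator ρ K₁) - GPSinkhorn.empSinkhorn2 ε K₀ K₁ (fun i => x i ω)
      = f01 ω - 1 / 2 * (f00 ω + f11 ω) := fun ω => by
    rw [GPSinkhorn.sinkhorn2_eq_entTerm, GPSinkhorn.empSinkhorn2_eq_empTerm]
    ring
  have hi : Integrable (fun ω => f01 ω - 1 / 2 * (f00 ω + f11 ω)) P :=
    i01.sub ((i00.add i11).const_mul _)
  have hd : Integrable (fun ω => 1 / 2 * (|f00 ω| + |f11 ω|)) P :=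
    (i00.abs.add i11.abs).const_mul _
  simp only [hf]
  refine ⟨hi.abs, ?_⟩
  have hle : ∀ ω, |f01 ω - 1 / 2 * (f00 ω + f11 ω)|
      ≤ |f01 ω| + 1 / 2 * (|f00 ω| + |f11 ω|) := fun ω => by
    refine (abs_sub _ _).trans ?_
    rw [abs_mul, abs_of_pos (show (0 : ℝ) < 1 / 2 by norm_num)]
    linarith [abs_add_le (f00 ω) (f11 ω)]
  set k₀ := GPSinkhorn.kernelSup K₀
  set k₁ := GPSinkhorn.kernelSup K₁
  calc ∫ ω, |f01 ω - 1 / 2 * (f00 ω + f11 ω)| ∂P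
      ≤ ∫ ω, (|f01 ω| + 1 / 2 * (|f00 ω| + |f11 ω|)) ∂P :=
        integral_mono hi.abs (i01.abs.add hd) hle
    _ = ∫ ω, |f01 ω| ∂P + 1 / 2 * (∫ ω, |f00 ω| ∂P + ∫ ω, |f11 ω| ∂P) := by
        rw [integral_add i01.abs hd, integral_const_mul,
          integral_add i00.abs i11.abs]
    _ ≤ 4 * (k₀ * k₁) / (ε * √n) + 1 / 2 * (4 * (k₀ * k₀) / (ε * √n) + 4 * (k₁ * k₁) / (ε * √n)) := by
        linarith
    -- `4 k₀ k₁ + 2 k₀² + 2 k₁² = 2 (k₀ + k₁)²`, so the argument yields half of the stated constant.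
    _ = 2 * (k₀ + k₁) ^ 2 / (ε * √n) := by ring
    _ ≤ 4 * (k₀ + k₁) ^ 2 / (ε * √n) := by
        gcongr
        norm_num
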